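/- Let $G$ be a finite connected simple graph with vertex set $V$, $n_v=|V|$, and internal edge set $E_{\rm int}$, and attach to its vertices $n$ external edges, the edge $s$ to the vertex $i(s)$. Let $a\ge1$, $b_e\ge 1$ ($e\in E_{\rm int}$) and $d_k\ge1$ ($k\in V$) be integers (physical, bond and logical dimensions), and let $q_k$ be the dimension of the leg space at $k$, i.e. the product of $d_k$, of the $b_e$ over the internal edges $e$ at $k$, and of one factor $a$ for each external edge at $k$. Let $U_k$ be independent Haar-random unitaries on $\mathbb C^{q_k}$, $|\psi_k\rangle=U_k|0_k\rangle$ for arbitrary fixed unit vectors $|0_k\rangle$, and let $|\Phi\rangle\in\bigotimes_k\mathbb C^{d_k}$ be a fixed unit vector. The random tensor network (RTN) state is $$|\psi\rangle=\langle\Phi|\bigotimes_{\langle j,k\rangle\in E_{\rm int}}\langle j\,k|\bigotimes_{k\in V}|\psi_k\rangle\in(\mathbb C^a)^{\otimes n},\qquad \langle j\,k|=\sum_{x}\langle x|\langle x| .$$ Put $$Z=Z_{\log\sqrt b,\log\sqrt a},\qquad Z_{J,h}=\frac{\sum_{\sigma\in\{\pm1\}^{V}}\exp\bigl(\sum_{e=\langle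 i,j\rangle\in E_{\rm int}}J_e\sigma_i\sigma_j+\sum_{s}h_s\sigma_{i(s)}\bigr)}{\exp\bigl(\sum_{e}J_e+\sum_{s}h_s\bigr)},$$ where $J_e=\log\sqrt{b_e}$, $h_s=\log\sqrt a$, and let $\eta=\dfrac{Z}{\prod_{k}(1+1/q_k)}-1$. 1. For every such RTN, $\langle\psi|\psi\rangle$ is integrable with $\mathbb E\langle\psi|\psi\rangle>0$, and for all $\varepsilon>0$ $$\mathbb P\left[\left(\frac{\langle\psi|\psi\rangle}{\mathbb E\langle\psi|\psi\rangle}-1\right)^2\ge\varepsilon\right]\le\frac1\varepsilon\left(\frac{Z}{\prod_k(1+1/q_k)}-1\right).$$ 2. If all bond dimensions are equal to $b$, the right-hand side is $O\bigl(\frac{n_v}{\varepsilon b}+\frac1{\varepsilon a^n}\bigr)$, uniformly over all RTNs for which $n_v/b$ stays bounded: for every $K$ there is a constant $C$, depending only on $K$, such that for all RTNs with all bond dimensions equal to $b$ and $n_v\le Kb$, and for all $\varepsilon>0$, $$\frac1\varepsilon\left(\frac{Z}{\prod_k(1+1/q_k)}-1\right)\le C\left(\frac{n_v}{\varepsilon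 b}+\frac1{\varepsilon a^n}\right).$$ 3. For every RTN as in 1 and every self-adjoint operator $O$ on $(\mathbb C^a)^{\otimes n}$, with operator norm $\|O\|$ (and with the convention $0/0=0$), the variables $\langle\psi|O|\psi\rangle$ and $\langle\psi|O|\psi\rangle/\langle\psi|\psi\rangle$ are integrable and $$\left|\,\mathbb E\!\left[\frac{\langle\psi|O|\psi\rangle}{\langle\psi|\psi\rangle}\right]-\frac{\mathbb E\langle\psi|O|\psi\rangle}{\mathbb E\langle\psi|\psi\rangle}\right|\le\sqrt\eta\,\|O\| .$$ If moreover $\mathbb E\langle\psi|O|\psi\rangle\ge0$, then for all $0<\varepsilon<1$ $$\frac{\mathbb E\langle\psi|O|\psi\rangle}{\mathbb E\langle\psi|\psi\rangle}\,\frac1{1+\sqrt\varepsilon}-\sqrt\eta\,\|O\|\;\le\;\mathbb E\!\left[\frac{\langle\psi|O|\psi\rangle}{\langle\psi|\psi\rangle}\right]\;\le\;\frac{\mathbb E\langle\psi|O|\psi\rangle}{\mathbb E\langle\psi|\psi\rangle}\,\frac1{1-\sqrt\varepsilon}+\sqrt\eta\,\|O\| .$$ -/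

import Mathlib

open MeasureTheory

noncomputable section

/- ## Haar-random unitaries -/

/-- The unitary group of finite size is compact: it is closed and its entries are bounded. -/
instance unitaryGroup_compactSpace (n : Type*) [Fintype n] [DecidableEq n] :
    CompactSpace (Matrix.unitaryGroup n ℂ) := by
  suffices h : IsCompact (Matrix.unitaryGroup n ℂ : Set (Matrix n n ℂ)) from
    isCompact_iff_compactSpace.mp h
  have hK : IsCompact {M : Matrix n n ℂ | ∀ i j, M i j ∈ Metric.closedBall (0 : ℂ) 1} :=
    IsCompact.matrix (isCompact_closedBall (0 : ℂ) 1)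
  refine hK.of_isClosed_subset ?_ ?_
  · have : (Matrix.unitaryGroup n ℂ : Set (Matrix n n ℂ)) =
        {M : Matrix n n ℂ | star M * M = 1} ∩ {M : Matrix n n ℂ | M * star M = 1} := by
      ext M
      exact Unitary.mem_iff
    rw [this]
    exact (isClosed_eq (by fun_prop) continuous_const).inter
      (isClosed_eq (by fun_prop) continuous_const)
  · intro M hM i j
    simpa using entry_norm_bound_of_unitary hM i j

/-- The unitary group carries its Borel sigma-algebra. -/
instance unitaryGroup_measurableSpace (n : Type*) [Fintype n] [DecidableEq n] :
    MeasurableSpace (Matrix.unitaryGroup n ℂ) := borel _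

instance unitaryGroup_borelSpace (n : Type*) [Fintype n] [DecidableEq n] :
    BorelSpace (Matrix.unitaryGroup n ℂ) := ⟨rfl⟩

/-- The Haar probability measure on the unitary group (the circular unitary ensemble). -/
def haarUnitary (n : Type*) [Fintype n] [DecidableEq n] : Measure (Matrix.unitaryGroup n ℂ) :=
  Measure.haarMeasure ⊤

instance haarUnitary_isProbabilityMeasure (n : Type*) [Fintype n] [DecidableEq n] :
    IsProbabilityMeasure (haarUnitary n) :=
  ⟨by
    have h := Measure.haarMeasure_self
      (K₀ := (⊤ : TopologicalSpace.PositiveCompacts (Matrix.unitaryGroup n ℂ)))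
    simpa [haarUnitary] using h⟩

/- ## Ising partition function with a boundary magnetic field -/

/-- The product `σ_i σ_j` of the two spins at the end points of the edge `e = ⟨i, j⟩`. -/
def spinPair {V : Type*} (σ : V → ℤˣ) (e : Sym2 V) : ℝ :=
  (((e.map σ).mul : ℤˣ) : ℤ)

/-- The Hamiltonian exponent `∑_{⟨i,j⟩} J_{⟨i,j⟩} σ_i σ_j + ∑_{⟨i,∅⟩} h_{⟨i,∅⟩} σ_i`.  The internal
edges are indexed by `E` with end points `ends`; the external edge `s : S` is attached to the
vertex `site s`. -/
def isingExponent {V E S : Type*} [Fintype E] [Fintype S] (ends : E → Sym2 V) (site : S → V)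
    (J : E → ℝ) (h : S → ℝ) (σ : V → ℤˣ) : ℝ :=
  ∑ e, J e * spinPair σ (ends e) + ∑ s, h s * (((σ (site s) : ℤˣ) : ℤ) : ℝ)

/-- The rescaled Ising partition function `Z_{J,h}`: the sum over all spin configurations
`σ ∈ {-1, 1}^V` of the Boltzmann weights, divided by the all-spins-up weight. -/
def isingZ {V E S : Type*} [Fintype V] [DecidableEq V] [Fintype E] [Fintype S]
    (ends : E → Sym2 V) (site : S → V) (J : E → ℝ) (h : S → ℝ) : ℝ :=
  (∑ σ : V → ℤˣ, Real.exp (isingExponent ends site J h σ)) /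
    Real.exp (∑ e, J e + ∑ s, h s)

/- ## Random tensor networks -/

/-- The geometry of a tensor network: a connected graph on the vertices (tensors) `V` whose edges
are the internal edges, external edges indexed by the physical sites `S`, each attached to one
vertex, and the (positive) physical, bond and logical dimensions. -/
structure TensorNetwork (V S : Type*) where
  graph : SimpleGraph V
  connected : graph.Connected
  site : S → V
  a : ℕ
  b : graph.edgeSet → ℕ
  d : V → ℕ
  a_pos : 0 < a
  b_pos : ∀ e, 0 < b e
  d_pos : ∀ v, 0 < d v

namespace TensorNetwork

variable {V S : Type*} [Fintype V] [DecidableEq V] [Fintype S] [DecidableEq S]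

/-- The internal edges. -/
def Edge (N : TensorNetwork V S) : Type _ := N.graph.edgeSet

/-- The two end points of an internal edge. -/
def ends (N : TensorNetwork V S) (e : N.Edge) : Sym2 V := Subtype.val e

/-- The bond dimension of an internal edge. -/
def bond (N : TensorNetwork V S) (e : N.Edge) : ℕ := N.b e

instance (N : TensorNetwork V S) : Finite N.Edge :=
  inferInstanceAs (Finite N.graph.edgeSet)

instance (N : TensorNetwork V S) : Fintype N.Edge := Fintype.ofFinite _

instance (N : TensorNetwork V S) : DecidableEq N.Edge := Classical.decEq _

/-- The total dimension `q_v` of the tensor at `v`: `a` to the number of its external legs, times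
its logical dimension, times the bond dimensions of its internal legs. -/
def q (N : TensorNetwork V S) (v : V) : ℕ :=
  N.a ^ Fintype.card {s : S // N.site s = v} * N.d v *
    ∏ e : {e : N.Edge // v ∈ N.ends e}, N.bond e.1

/-- Basis labels of the total leg space of the tensor at `v`: one index for each external leg, one
for each internal leg, and a logical one. -/
def Idx (N : TensorNetwork V S) (v : V) : Type _ :=
  ({s : S // N.site s = v} → Fin N.a) ×
    (∀ e : {e : N.Edge // v ∈ N.ends e}, Fin (N.bond e.1)) × Fin (N.d v)

instance (N : TensorNetwork V S) (v : V) : Fintype (N.Idx v) :=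
  inferInstanceAs (Fintype (({s : S // N.site s = v} → Fin N.a) ×
    (∀ e : {e : N.Edge // v ∈ N.ends e}, Fin (N.bond e.1)) × Fin (N.d v)))

instance (N : TensorNetwork V S) (v : V) : DecidableEq (N.Idx v) := Classical.decEq _

/-- The bulk Hilbert space: the tensor product of the logical spaces `ℂ^{d_v}`. -/
abbrev Bulk (N : TensorNetwork V S) : Type _ := EuclideanSpace ℂ (∀ v, Fin (N.d v))

/-- The physical (boundary) Hilbert space `(ℂ^a)^{⊗ n}`. -/
abbrev Boundary (N : TensorNetwork V S) : Type _ := EuclideanSpace ℂ (S → Fin N.a)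

/-- The tensor network state
`|ψ⟩ = ⟨Φ| ⨂_{⟨j,k⟩} ⟨j k| ⨂_i |ψ_i⟩` of the tensors `T i`, in coordinates.  Contraction with the
EPR pair `⟨j k| = ∑_x ⟨x| ⟨x|` gives the two legs of an internal edge a common index that is
summed over. -/
def state (N : TensorNetwork V S) (Φ : N.Bulk) (T : ∀ v, EuclideanSpace ℂ (N.Idx v)) :
    N.Boundary :=
  WithLp.toLp 2 fun x =>
    ∑ l : ∀ v, Fin (N.d v), ∑ y : ∀ e : N.Edge, Fin (N.bond e),
      star (Φ l) * ∏ v, T v (fun s => x s.1, fun e => y e.1, l v)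

/-- The sample space: one unitary on the total leg space of every vertex. -/
abbrev Sample (N : TensorNetwork V S) : Type _ := ∀ v, Matrix.unitaryGroup (N.Idx v) ℂ

/-- The unitaries are Haar-random and independent. -/
def law (N : TensorNetwork V S) : Measure N.Sample :=
  Measure.pi fun v => haarUnitary (N.Idx v)

instance (N : TensorNetwork V S) : IsProbabilityMeasure N.law := by
  unfold law; infer_instance

/-- The random tensor network state `|ψ⟩`, with `|ψ_v⟩ = U_v |0_v⟩` for reference vectors
`|0_v⟩ = ref v`. -/
def psi (N : TensorNetwork V S) (Φ : N.Bulk) (ref : ∀ v, EuclideanSpace ℂ (N.Idx v))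
    (U : N.Sample) : N.Boundary :=
  N.state Φ fun v => WithLp.toLp 2 ((U v : Matrix (N.Idx v) (N.Idx v) ℂ).mulVec (ref v))

/-- `⟨ψ|O|ψ⟩`, which is real for self-adjoint `O`. -/
def expval (N : TensorNetwork V S) (Φ : N.Bulk) (ref : ∀ v, EuclideanSpace ℂ (N.Idx v))
    (O : N.Boundary →L[ℂ] N.Boundary) (U : N.Sample) : ℝ :=
  (inner ℂ (N.psi Φ ref U) (O (N.psi Φ ref U))).re

/-- The squared norm `⟨ψ|ψ⟩`. -/
def normSq (N : TensorNetwork V S) (Φ : N.Bulk) (ref : ∀ v, EuclideanSpace ℂ (N.Idx v))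
    (U : N.Sample) : ℝ :=
  ‖N.psi Φ ref U‖ ^ 2

/-- The Ising partition function `Z_{log √b, log √a}` of the network. -/
def Z (N : TensorNetwork V S) : ℝ :=
  isingZ N.ends N.site (fun e => Real.log (Real.sqrt (N.bond e)))
    (fun _ => Real.log (Real.sqrt N.a))

/-- `η = Z_{log √b, log √a} / ∏_k (1 + 1/q_k) - 1`. -/
def eta (N : TensorNetwork V S) : ℝ :=
  N.Z / ∏ v, (1 + 1 / (N.q v : ℝ)) - 1

end TensorNetwork

end

set_option linter.unusedSectionVars false

noncomputable section

/- ## Moments of a Haar-random vector -/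

section Haar

variable {n : Type*} [Fintype n] [DecidableEq n]

/-! Everything rests on the second moment of X = ⟨ψ|ψ⟩. By independence E[X²] factorizes over
vertices into fourth moments of Haar vectors, and each of these is a sum over two pairings of kets
with bras, divided by q(q+1) (`haarMoment_eq`). A choice of pairing at every vertex is a spin
configuration. Its contribution splits by type of leg: an external leg gives a² or a, a bond at most
b² or b according to whether its end spins agree, and the logical legs at most 1, a purity bound for
Φ. Relative to (E X)² these are the Ising weights, and q² / (q(q+1)) supplies 1/(1+1/q). So the
relative variance of X is at most η, and Markov's inequality gives the deviation bound.

The asymptotic form comes from a spanning tree: a configuration is determined by its root spin and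
the products along tree edges, so Z is at most 2(1+1/b)^{n_v}; the all-down configuration is counted
separately with its exact weight a^{-n}.

For expectation values, the quotient R = ⟨ψ|O|ψ⟩/X is bounded by ‖O‖ and R - ⟨ψ|O|ψ⟩/E X = -R (X/E X
- 1). The mean of |X/E X - 1| is at most √η. -/

instance unitaryGroup_secondCountable : SecondCountableTopology (Matrix.unitaryGroup n ℂ) :=
  have : SecondCountableTopology (Matrix n n ℂ) :=
    inferInstanceAs (SecondCountableTopology (n → n → ℂ))
  inferInstanceAs (SecondCountableTopology ((Matrix.unitaryGroup n ℂ : Set (Matrix n n ℂ))))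

instance haarUnitary_isMulLeftInvariant : (haarUnitary n).IsMulLeftInvariant := by
  unfold haarUnitary; infer_instance

/-- The random vector `U r`. -/
def haarVec (r : n → ℂ) (U : Matrix.unitaryGroup n ℂ) : n → ℂ :=
  (U : Matrix n n ℂ).mulVec r

@[fun_prop]
theorem continuous_haarVec (r : n → ℂ) : Continuous (haarVec r) := by
  unfold haarVec; fun_prop

@[fun_prop]
theorem continuous_haarVec_apply (r : n → ℂ) (i : n) : Continuous fun U => haarVec r U i :=
  (continuous_apply i).comp (continuous_haarVec r)

theorem integrable_haarUnitary {E : Type*} [NormedAddCommGroup E]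
    {f : Matrix.unitaryGroup n ℂ → E} (hf : Continuous f) : Integrable f (haarUnitary n) :=
  hf.integrable_of_hasCompactSupport (HasCompactSupport.of_compactSpace f)

/-- Left invariance of Haar measure, the only symmetry used to find the moments; it is applied to
`phaseAt` and `planeReflection`. -/
theorem integral_haarVec_mulVec (r : n → ℂ) (W : Matrix.unitaryGroup n ℂ) (F : (n → ℂ) → ℂ) :
    ∫ U, F ((W : Matrix n n ℂ).mulVec (haarVec r U)) ∂haarUnitary n =
      ∫ U, F (haarVec r U) ∂haarUnitary n := by
  rw [← integral_mul_left_eq_self (fun U => F (haarVec r U)) W]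
  simp [haarVec, Matrix.mulVec_mulVec]

/-- The fourth moment `𝔼[t_i t̄_j t_k t̄_l]` of the components of a Haar-random vector. -/
def haarMoment (r : n → ℂ) (i j k l : n) : ℂ :=
  ∫ U, haarVec r U i * star (haarVec r U j) * (haarVec r U k * star (haarVec r U l))
    ∂haarUnitary n

/-- The diagonal unitary with entry `i` (the imaginary unit) at `m` and `1` elsewhere. -/
def phaseAt (m : n) : Matrix.unitaryGroup n ℂ :=
  ⟨Matrix.diagonal fun i => if i = m then Complex.I else 1, by
    rw [Matrix.mem_unitaryGroup_iff, Matrix.star_eq_conjTranspose, Matrix.diagonal_conjTranspose,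
      Matrix.diagonal_mul_diagonal, ← Matrix.diagonal_one]
    congr 1
    ext i
    by_cases h : i = m <;> simp [h]⟩

theorem haarMoment_phase (r : n → ℂ) (m i j k l : n) :
    ((if i = m then Complex.I else 1) * star (if j = m then Complex.I else 1) *
      ((if k = m then Complex.I else 1) * star (if l = m then Complex.I else 1))) *
      haarMoment r i j k l = haarMoment r i j k l := by
  conv_rhs => rw [haarMoment, ← integral_haarVec_mulVec r (phaseAt m)
    (fun t => t i * star (t j) * (t k * star (t l)))]
  rw [haarMoment, ← integral_const_mul]
  congr 1
  ext U
  simp only [phaseAt, Matrix.mulVec_diagonal, star_mul']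
  ring

/-- If kets and bras do not pair up, some label m occurs unequally often among i, k and among j, l,
and `phaseAt m` multiplies the moment by a factor other than 1. A sign in place of the imaginary
unit would miss the case i = k, j = l ≠ i. -/
theorem haarMoment_eq_zero (r : n → ℂ) {i j k l : n} (h1 : ¬(i = j ∧ k = l))
    (h2 : ¬(i = l ∧ k = j)) : haarMoment r i j k l = 0 := by
  have key : ∀ c : ℂ, c ≠ 1 → c * haarMoment r i j k l = haarMoment r i j k l →
      haarMoment r i j k l = 0 := by
    intro c hc h
    have : (c - 1) * haarMoment r i j k l = 0 := by linear_combination h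
    exact (mul_eq_zero.mp this).resolve_left (sub_ne_zero.mpr hc)
  have hI : Complex.I ≠ 1 := fun h => by simpa using congrArg Complex.im h
  by_cases hij : i = j
  · have hkl : l ≠ k := fun h => h1 ⟨hij, h.symm⟩
    refine key _ ?_ (haarMoment_phase r k i j k l)
    subst hij
    by_cases hik : i = k <;> simp [hik, hkl, hI]
  · by_cases hil : i = l
    · have hkj : j ≠ k := fun h => h2 ⟨hil, h.symm⟩
      refine key _ ?_ (haarMoment_phase r k i j k l)
      subst hil
      by_cases hik : i = k <;> simp [hik, hkj, hI]
    · refine key _ ?_ (haarMoment_phase r i i j k l)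
      by_cases hki : k = i
      · simp [hki, Ne.symm hij, Ne.symm hil]
        norm_num [Complex.ext_iff]
      · simp [hki, Ne.symm hij, Ne.symm hil, hI]

/-- The reflection in the plane of two basis vectors along the normal `2 e_i - e_j`. -/
def planeReflection {i j : n} (hij : i ≠ j) : Matrix.unitaryGroup n ℂ :=
  ⟨1 - (2 / 5 : ℂ) • Matrix.vecMulVec (Pi.single i 2 - Pi.single j 1)
      (Pi.single i 2 - Pi.single j 1), by
    set v : n → ℂ := Pi.single i 2 - Pi.single j 1 with hv
    have hvv : v ⬝ᵥ v = 5 := by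
      simp [hv, dotProduct_sub, hij, hij.symm]; norm_num
    have hsv : star v = v := by
      ext a
      by_cases h1 : a = i
      · subst h1; simp [hv, hij]
      · by_cases h2 : a = j
        · subst h2; simp [hv, h1]
        · simp [hv, h1, h2]
    have hs : star (1 - (2 / 5 : ℂ) • Matrix.vecMulVec v v) =
        1 - (2 / 5 : ℂ) • Matrix.vecMulVec v v := by
      rw [Matrix.star_eq_conjTranspose, Matrix.conjTranspose_sub, Matrix.conjTranspose_smul,
        Matrix.conjTranspose_vecMulVec, hsv]
      simp
    rw [Matrix.mem_unitaryGroup_iff, hs]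
    have hm : Matrix.vecMulVec v v * Matrix.vecMulVec v v = (5 : ℂ) • Matrix.vecMulVec v v := by
      rw [Matrix.vecMulVec_mul_vecMulVec, hvv]
      ext a b
      simp [Matrix.vecMulVec_apply]
      ring
    rw [sub_mul, mul_sub, mul_sub]
    simp only [one_mul, mul_one, smul_mul_assoc, mul_smul_comm, hm, smul_smul]
    module⟩

theorem planeReflection_mulVec_left {i j : n} (hij : i ≠ j) (t : n → ℂ) :
    ((planeReflection hij : Matrix n n ℂ).mulVec t) i = (-3 * t i + 4 * t j) / 5 := by
  simp [planeReflection, Matrix.sub_mulVec, Matrix.smul_mulVec, Matrix.vecMulVec_mulVec,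
    sub_dotProduct, hij]
  ring

theorem planeReflection_mulVec_right {i j : n} (hij : i ≠ j) (t : n → ℂ) :
    ((planeReflection hij : Matrix n n ℂ).mulVec t) j = (4 * t i + 3 * t j) / 5 := by
  simp [planeReflection, Matrix.sub_mulVec, Matrix.smul_mulVec, Matrix.vecMulVec_mulVec,
    sub_dotProduct, hij.symm]
  ring

/-- Expansion of the square of a real quadratic form in two components of a Haar-random vector. -/
theorem integral_haarVec_quadratic (r : n → ℂ) {i j : n} (hij : i ≠ j) (α β γ : ℝ) :
    ∫ U, (α * haarVec r U i ^ 2 + β * (haarVec r U i * haarVec r U j) + γ * haarVec r U j ^ 2) *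
      star (α * haarVec r U i ^ 2 + β * (haarVec r U i * haarVec r U j) +
        γ * haarVec r U j ^ 2) ∂haarUnitary n =
      α ^ 2 * haarMoment r i i i i + β ^ 2 * haarMoment r i i j j +
        γ ^ 2 * haarMoment r j j j j := by
  have e : ∀ t : n → ℂ, (α * t i ^ 2 + β * (t i * t j) + γ * t j ^ 2) *
      star (α * t i ^ 2 + β * (t i * t j) + γ * t j ^ 2) =
      (α ^ 2 : ℂ) * (t i * star (t i) * (t i * star (t i))) +
      (β ^ 2 : ℂ) * (t i * star (t i) * (t j * star (t j))) +
      (γ ^ 2 : ℂ) * (t j * star (t j) * (t j * star (t j))) +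
      (α * β : ℂ) * (t i * star (t i) * (t i * star (t j))) +
      (α * β : ℂ) * (t i * star (t i) * (t j * star (t i))) +
      (α * γ : ℂ) * (t i * star (t j) * (t i * star (t j))) +
      (α * γ : ℂ) * (t j * star (t i) * (t j * star (t i))) +
      (β * γ : ℂ) * (t i * star (t j) * (t j * star (t j))) +
      (β * γ : ℂ) * (t j * star (t i) * (t j * star (t j))) := by
    intro t
    simp only [star_add, star_mul', star_pow, Complex.star_def, Complex.conj_ofReal]
    ring
  simp_rw [e]
  repeat rw [integral_add (integrable_haarUnitary (by fun_prop))
    (integrable_haarUnitary (by fun_prop))]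
  simp only [integral_const_mul]
  simp only [← haarMoment.eq_1]
  rw [haarMoment_eq_zero r (i := i) (j := i) (k := i) (l := j) (by grind) (by grind),
    haarMoment_eq_zero r (i := i) (j := i) (k := j) (l := i) (by grind) (by grind),
    haarMoment_eq_zero r (i := i) (j := j) (k := i) (l := j) (by grind) (by grind),
    haarMoment_eq_zero r (i := j) (j := i) (k := j) (l := i) (by grind) (by grind),
    haarMoment_eq_zero r (i := i) (j := j) (k := j) (l := j) (by grind) (by grind),
    haarMoment_eq_zero r (i := j) (j := i) (k := j) (l := j) (by grind) (by grind)]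
  ring

/-- The reflection has the rational entries ∓3/5 and 4/5, so it maps t_i t_j and t_i² to rational
quadratic forms in t_i, t_j. Invariance of the mean square modulus of each gives two linear
equations for the three moments. -/
theorem haarMoment_eq_of_ne (r : n → ℂ) {i j : n} (hij : i ≠ j) :
    haarMoment r i i i i = haarMoment r j j j j ∧
      haarMoment r i i i i = 2 * haarMoment r i i j j := by
  have h1 : haarMoment r i i j j = (-12 / 25 : ℝ) ^ 2 * haarMoment r i i i i +
      (7 / 25 : ℝ) ^ 2 * haarMoment r i i j j + (12 / 25 : ℝ) ^ 2 * haarMoment r j j j j := by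
    rw [← integral_haarVec_quadratic r hij]
    conv_lhs => rw [haarMoment, ← integral_haarVec_mulVec r (planeReflection hij)
      (fun t => t i * star (t i) * (t j * star (t j)))]
    congr 1
    ext U
    simp only [planeReflection_mulVec_left, planeReflection_mulVec_right, Complex.star_def,
      map_add, map_mul, map_div₀, map_neg, map_pow, map_ofNat, Complex.conj_ofReal]
    push_cast
    ring
  have h2 : haarMoment r i i i i = (9 / 25 : ℝ) ^ 2 * haarMoment r i i i i +
      (-24 / 25 : ℝ) ^ 2 * haarMoment r i i j j + (16 / 25 : ℝ) ^ 2 * haarMoment r j j j j := by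
    rw [← integral_haarVec_quadratic r hij]
    conv_lhs => rw [haarMoment, ← integral_haarVec_mulVec r (planeReflection hij)
      (fun t => t i * star (t i) * (t i * star (t i)))]
    congr 1
    ext U
    simp only [planeReflection_mulVec_left, Complex.star_def,
      map_add, map_mul, map_div₀, map_neg, map_pow, map_ofNat, Complex.conj_ofReal]
    push_cast
    ring
  push_cast at h1 h2
  -- In the sum of the two equations the mixed moment cancels.
  have h3 : haarMoment r i i i i = haarMoment r j j j j := by
    linear_combination (25 / 16 : ℂ) * h2 + (25 / 16 : ℂ) * h1
  refine ⟨h3, ?_⟩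
  rw [← h3] at h1
  linear_combination (-625 / 288 : ℂ) * h1

theorem sum_haarVec_mul_star {r : n → ℂ} (hr : ∑ i, r i * star (r i) = 1)
    (U : Matrix.unitaryGroup n ℂ) : ∑ i, haarVec r U i * star (haarVec r U i) = 1 := by
  have h : star (haarVec r U) ⬝ᵥ haarVec r U = 1 := by
    rw [haarVec, Matrix.star_mulVec, Matrix.dotProduct_mulVec, Matrix.vecMul_vecMul,
      ← Matrix.star_eq_conjTranspose, Matrix.mem_unitaryGroup_iff'.mp U.2, Matrix.vecMul_one,
      ← hr]
    simp [dotProduct, mul_comm]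
  rw [← h]
  simp [dotProduct, mul_comm]

/-- Unit length of U r contracts the second ket-bra pair. This fixes the normalization and later
reduces the second moment to the fourth. -/
theorem sum_haarMoment {r : n → ℂ} (hr : ∑ i, r i * star (r i) = 1) (i j : n) :
    ∑ k, haarMoment r i j k k =
      ∫ U, haarVec r U i * star (haarVec r U j) ∂haarUnitary n := by
  simp_rw [haarMoment]
  rw [← integral_finsetSum _ fun k _ => integrable_haarUnitary (by fun_prop)]
  congr 1
  ext U
  rw [← Finset.mul_sum, sum_haarVec_mul_star hr, mul_one]

theorem sum_sum_haarMoment {r : n → ℂ} (hr : ∑ i, r i * star (r i) = 1) :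
    ∑ i, ∑ k, haarMoment r i i k k = 1 := by
  simp_rw [sum_haarMoment hr]
  rw [← integral_finsetSum _ fun k _ => integrable_haarUnitary (by fun_prop)]
  simp_rw [sum_haarVec_mul_star hr]
  simp

/-- With A the common diagonal moment, E|t_j|²|t_k|² = A(1+δ_jk)/2. These sum to 1, so A q(q+1)/2 =
1 for q the dimension. -/
theorem haarMoment_self {r : n → ℂ} (hr : ∑ i, r i * star (r i) = 1) (i : n) :
    haarMoment r i i i i = 2 / (Fintype.card n * (Fintype.card n + 1)) := by
  have hA : ∀ j k, haarMoment r j j k k =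
      haarMoment r i i i i * (if k = j then 1 else 0) * (1 / 2) + haarMoment r i i i i / 2 := by
    intro j k
    have hj : haarMoment r j j j j = haarMoment r i i i i := by
      by_cases h : j = i
      · rw [h]
      · exact (haarMoment_eq_of_ne r h).1
    by_cases h : j = k
    · subst h
      rw [if_pos rfl, hj]; ring
    · rw [if_neg (Ne.symm h), ← hj, (haarMoment_eq_of_ne r h).2]; ring
  have h1 := sum_sum_haarMoment hr
  rw [Finset.sum_congr rfl fun j _ => Finset.sum_congr rfl fun k _ => hA j k] at h1
  simp [Finset.sum_add_distrib] at h1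
  have hc : (Fintype.card n : ℂ) ≠ 0 := by
    have : Nonempty n := ⟨i⟩
    exact_mod_cast Fintype.card_ne_zero
  have hc' : (Fintype.card n : ℂ) + 1 ≠ 0 := by
    exact_mod_cast Nat.succ_ne_zero (Fintype.card n)
  field_simp
  linear_combination 2 * h1

/-- The fourth moment of a Haar-random unit vector. -/
theorem haarMoment_eq {r : n → ℂ} (hr : ∑ i, r i * star (r i) = 1) (i j k l : n) :
    haarMoment r i j k l =
      ((if i = j ∧ k = l then 1 else 0) + (if i = l ∧ k = j then 1 else 0)) /
        (Fintype.card n * (Fintype.card n + 1)) := by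
  by_cases h1 : i = j ∧ k = l
  · obtain ⟨rfl, rfl⟩ := h1
    by_cases hik : i = k
    · subst hik
      rw [haarMoment_self hr]; norm_num
    · have := (haarMoment_eq_of_ne r hik).2
      rw [haarMoment_self hr] at this
      simp [hik]
      rw [← mul_inv, ← one_div]
      linear_combination (-1 / 2 : ℂ) * this
  · by_cases h2 : i = l ∧ k = j
    · obtain ⟨rfl, rfl⟩ := h2
      have hik : i ≠ k := fun h => h1 ⟨h, h.symm⟩
      have := (haarMoment_eq_of_ne r hik).2
      rw [haarMoment_self hr] at this
      have hs : haarMoment r i k k i = haarMoment r i i k k := by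
        unfold haarMoment; congr 1; ext U; ring
      simp [hik, hs]
      rw [← mul_inv, ← one_div]
      linear_combination (-1 / 2 : ℂ) * this
    · simp [h1, h2, haarMoment_eq_zero r h1 h2]

/-- The second moment of a Haar-random unit vector. -/
theorem integral_haarVec_mul_star {r : n → ℂ} (hr : ∑ i, r i * star (r i) = 1) (i j : n) :
    ∫ U, haarVec r U i * star (haarVec r U j) ∂haarUnitary n =
      (if i = j then 1 else 0) / Fintype.card n := by
  rw [← sum_haarMoment hr]
  simp_rw [haarMoment_eq hr]
  have hc : (Fintype.card n : ℂ) ≠ 0 := by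
    have : Nonempty n := ⟨i⟩
    exact_mod_cast Fintype.card_ne_zero
  have hc' : (Fintype.card n : ℂ) + 1 ≠ 0 := by
    exact_mod_cast Nat.succ_ne_zero (Fintype.card n)
  have h2 : ∀ k, (if i = k ∧ k = j then (1 : ℂ) else 0) =
      if i = k then (if i = j then 1 else 0) else 0 := by
    intro k; grind
  rw [← Finset.sum_div, Finset.sum_add_distrib]
  simp_rw [h2]
  by_cases h : i = j <;> simp [h]
  field_simp

end Haar

/- ## Bounds on the Ising partition function -/

/-- The next vertex on a geodesic to r. Choosing such a parent for every v ≠ r encodes a spanning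
tree. -/
theorem SimpleGraph.Connected.exists_adj_dist_lt {V : Type*} {G : SimpleGraph V}
    (hG : G.Connected) {r v : V} (h : v ≠ r) : ∃ w, G.Adj v w ∧ G.dist w r < G.dist v r := by
  obtain ⟨p, hp⟩ := hG.exists_walk_length_eq_dist v r
  cases p with
  | nil => exact absurd rfl h
  | cons hadj q =>
    refine ⟨_, hadj, ?_⟩
    have := SimpleGraph.dist_le q
    simp at hp
    omega

theorem spinPair_mk {V : Type*} (σ : V → ℤˣ) (i j : V) :
    spinPair σ s(i, j) = if σ i = σ j then 1 else -1 := by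
  rcases Int.units_eq_one_or (σ i) with h | h <;> rcases Int.units_eq_one_or (σ j) with h' | h' <;>
    simp [spinPair, h, h']

theorem spinPair_eq_one_or {V : Type*} (σ : V → ℤˣ) (e : Sym2 V) :
    spinPair σ e = 1 ∨ spinPair σ e = -1 := by
  induction e with
  | _ i j => rw [spinPair_mk]; split_ifs <;> simp

/-- The Boltzmann factor of an edge or an external leg of dimension `b`, for the spin product `s`. -/
theorem exp_log_sqrt_mul {b : ℕ} (hb : 0 < b) (s : ℝ) (hs : s = 1 ∨ s = -1) :
    Real.exp (Real.log (Real.sqrt b) * s - Real.log (Real.sqrt b)) =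
      if s = 1 then 1 else (b : ℝ)⁻¹ := by
  have hb' : (0 : ℝ) < b := by exact_mod_cast hb
  rcases hs with rfl | rfl
  · simp
  · rw [if_neg (by norm_num), Real.log_sqrt hb'.le,
      show Real.log b / 2 * -1 - Real.log b / 2 = -Real.log b by ring, Real.exp_neg,
      Real.exp_log hb']

namespace TensorNetwork

variable {V S : Type*} [Fintype V] [DecidableEq V] [Fintype S] [DecidableEq S]

/-- The Boltzmann weight of a spin configuration relative to the all-up one. -/
def weight (N : TensorNetwork V S) (σ : V → ℤˣ) : ℝ :=
  (∏ e : N.Edge, if spinPair σ (N.ends e) = 1 then 1 else (N.bond e : ℝ)⁻¹) *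
    ∏ s : S, if σ (N.site s) = 1 then 1 else (N.a : ℝ)⁻¹

theorem bond_pos (N : TensorNetwork V S) (e : N.Edge) : 0 < N.bond e := N.b_pos e

theorem Z_eq_sum_weight (N : TensorNetwork V S) : N.Z = ∑ σ, N.weight σ := by
  rw [Z, isingZ, Finset.sum_div]
  refine Finset.sum_congr rfl fun σ _ => ?_
  rw [← Real.exp_sub, isingExponent, add_sub_add_comm, Real.exp_add, ← Finset.sum_sub_distrib,
    ← Finset.sum_sub_distrib, Real.exp_sum, Real.exp_sum, weight]
  congr 1
  · exact Finset.prod_congr rfl fun e _ =>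
      exp_log_sqrt_mul (N.bond_pos e) _ (spinPair_eq_one_or _ _)
  · refine Finset.prod_congr rfl fun s _ => ?_
    rw [exp_log_sqrt_mul N.a_pos]
    · rcases Int.units_eq_one_or (σ (N.site s)) with h | h <;> simp [h]
      norm_num
    · rcases Int.units_eq_one_or (σ (N.site s)) with h | h <;> simp [h]

theorem weight_nonneg (N : TensorNetwork V S) (σ : V → ℤˣ) : 0 ≤ N.weight σ := by
  unfold weight; positivity

/-- All factors are at most 1, so external legs and non-tree edges may be dropped. Distinct vertices
have distinct parent edges, since two vertices cannot each be strictly closer to r than the other.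
The root is padded with a factor 1. -/
theorem weight_le_tree (N : TensorNetwork V S) {b : ℕ} (hb : 0 < b) (hN : ∀ e, N.bond e = b)
    {r : V} {p : V → V}
    (hp : ∀ v, v ≠ r → N.graph.Adj v (p v) ∧ N.graph.dist (p v) r < N.graph.dist v r)
    (σ : V → ℤˣ) :
    N.weight σ ≤ ∏ v, if (if v = r then 1 else σ v * σ (p v)) = 1 then 1 else (b : ℝ)⁻¹ := by
  have hb1 : (b : ℝ)⁻¹ ≤ 1 := inv_le_one_of_one_le₀ (by exact_mod_cast hb)
  have ha1 : (N.a : ℝ)⁻¹ ≤ 1 := inv_le_one_of_one_le₀ (by exact_mod_cast N.a_pos)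
  let f : {v // v ≠ r} → N.Edge := fun v => ⟨s(v.1, p v.1), (hp v.1 v.2).1⟩
  have hf : Function.Injective f := by
    rintro ⟨v, hv⟩ ⟨w, hw⟩ h
    have h' : s(v, p v) = s(w, p w) := congrArg Subtype.val h
    rw [Sym2.eq_iff] at h'
    rcases h' with h' | h'
    · exact Subtype.ext h'.1
    · exfalso
      have h1 := (hp v hv).2
      have h2 := (hp w hw).2
      rw [h'.2] at h1
      rw [← h'.1] at h2
      omega
  have hfac : ∀ e : N.Edge, (0 : ℝ) ≤ (if spinPair σ (N.ends e) = 1 then 1 else (b : ℝ)⁻¹) ∧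
      (if spinPair σ (N.ends e) = 1 then 1 else (b : ℝ)⁻¹) ≤ 1 := by
    intro e; split_ifs
    · simp
    · exact ⟨by positivity, hb1⟩
  calc N.weight σ
      ≤ (∏ e : N.Edge, if spinPair σ (N.ends e) = 1 then 1 else (b : ℝ)⁻¹) * 1 := by
        unfold weight
        simp_rw [hN]
        refine mul_le_mul_of_nonneg_left (Finset.prod_le_one ?_ ?_)
          (Finset.prod_nonneg fun e _ => (hfac e).1)
        · intro s _; positivity
        · intro s _; split_ifs <;> simp [ha1]
    _ ≤ ∏ e ∈ Finset.univ.map ⟨f, hf⟩, if spinPair σ (N.ends e) = 1 then 1 else (b : ℝ)⁻¹ := by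
        rw [mul_one]
        exact Finset.prod_le_prod_of_subset_of_le_one (Finset.subset_univ _)
          (fun e _ => (hfac e).1) (fun e _ _ => (hfac e).2)
    _ = ∏ v : {v // v ≠ r}, if σ v.1 * σ (p v.1) = 1 then 1 else (b : ℝ)⁻¹ := by
        rw [Finset.prod_map]
        refine Finset.prod_congr rfl fun v _ => ?_
        have : N.ends (f v) = s(v.1, p v.1) := rfl
        simp only [Function.Embedding.coeFn_mk, this, spinPair_mk]
        rcases Int.units_eq_one_or (σ v.1) with h | h <;>
          rcases Int.units_eq_one_or (σ (p v.1)) with h' | h' <;> simp [h, h'] <;> norm_num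
    _ = _ := by
        rw [← Fintype.prod_subtype_mul_prod_subtype (fun v => v ≠ r)]
        rw [Finset.prod_eq_one (s := (Finset.univ : Finset {v // ¬ v ≠ r})), mul_one]
        · exact Finset.prod_congr rfl fun v _ => by rw [if_neg v.2]
        · rintro ⟨v, hv⟩ _
          simp [not_not.mp hv]

/-- A spanning tree bounds the partition function: its links carry independent spin products. -/
theorem Z_sub_one_le (N : TensorNetwork V S) {b : ℕ} (hb : 0 < b) (hN : ∀ e, N.bond e = b) :
    N.Z - 1 ≤ 2 * ((1 + (b : ℝ)⁻¹) ^ Fintype.card V - 1) + ((N.a : ℝ) ^ Fintype.card S)⁻¹ := by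
  obtain ⟨r⟩ := N.connected.nonempty
  have hex : ∀ v, ∃ w, v ≠ r → N.graph.Adj v w ∧ N.graph.dist w r < N.graph.dist v r := by
    intro v
    by_cases h : v = r
    · exact ⟨r, fun h' => absurd h h'⟩
    · obtain ⟨w, hw⟩ := N.connected.exists_adj_dist_lt h
      exact ⟨w, fun _ => hw⟩
  choose p hp using hex
  -- Root spin and tree-edge products. The dummy value at r lets the second component range over all
  -- of `V → ℤˣ`, at the price of the exponent n_v instead of n_v - 1.
  let g : (V → ℤˣ) → ℤˣ × (V → ℤˣ) :=
    fun σ => (σ r, fun v => if v = r then 1 else σ v * σ (p v))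
  have hg : Function.Injective g := by
    intro σ τ h
    have h0 : σ r = τ r := congrArg Prod.fst h
    have h1 : ∀ v, v ≠ r → σ v * σ (p v) = τ v * τ (p v) := by
      intro v hv
      have := congrFun (congrArg Prod.snd h) v
      simpa [g, hv] using this
    -- Spins are recovered outward from the root, by induction on the distance to it.
    have : ∀ k v, N.graph.dist v r = k → σ v = τ v := by
      intro k
      induction k using Nat.strong_induction_on with
      | _ k ih =>
        intro v hv
        by_cases hvr : v = r
        · rw [hvr, h0]
        · have h2 := ih _ (hv ▸ (hp v hvr).2) (p v) rfl
          have h3 := h1 v hvr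
          rw [h2] at h3
          exact mul_right_cancel h3
    exact funext fun v => this _ v rfl
  let F : (V → ℤˣ) → ℝ := fun τ => ∏ v, if τ v = 1 then 1 else (b : ℝ)⁻¹
  have hF : ∑ τ, F τ = (1 + (b : ℝ)⁻¹) ^ Fintype.card V := by
    have h2 : ∑ u : ℤˣ, (if u = 1 then 1 else (b : ℝ)⁻¹) = 1 + (b : ℝ)⁻¹ := by
      rw [show (Finset.univ : Finset ℤˣ) = {1, -1} from rfl, Finset.sum_pair (by decide)]
      simp
    rw [← Fintype.prod_sum (fun (_ : V) (u : ℤˣ) => if u = 1 then 1 else (b : ℝ)⁻¹), h2]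
    simp
  have hF0 : ∀ τ, 0 ≤ F τ := fun τ => Finset.prod_nonneg fun v _ => by positivity
  have hle : ∀ σ, N.weight σ ≤ F (g σ).2 := fun σ => N.weight_le_tree hb hN hp σ
  -- The all-down configuration has no unlike neighbours, so its tree bound is only 1. Trading that
  -- 1 for the exact weight leaves a single constant 1 in the bound on Z.
  have hneg : N.weight (fun _ => -1) = ((N.a : ℝ) ^ Fintype.card S)⁻¹ := by
    have h1 : ∀ e, spinPair (fun _ : V => (-1 : ℤˣ)) e = 1 := by
      intro e
      induction e with
      | _ i j => rw [spinPair_mk, if_pos rfl]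
    simp [weight, h1]
  have hFneg : F (g fun _ => -1).2 = 1 := by
    simp [F, g]
  have hsum : ∑ σ, F (g σ).2 ≤ 2 * (1 + (b : ℝ)⁻¹) ^ Fintype.card V := by
    calc ∑ σ, F (g σ).2 = ∑ x ∈ Finset.univ.map ⟨g, hg⟩, F x.2 := by
          rw [Finset.sum_map]; rfl
      _ ≤ ∑ x : ℤˣ × (V → ℤˣ), F x.2 :=
          Finset.sum_le_sum_of_subset_of_nonneg (Finset.subset_univ _) fun x _ _ => hF0 _
      _ = _ := by
          rw [Fintype.sum_prod_type]
          simp [hF]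
  rw [Z_eq_sum_weight]
  have := Finset.sum_le_sum (s := Finset.univ.erase (fun _ : V => (-1 : ℤˣ))) fun σ _ => hle σ
  have e1 := Finset.add_sum_erase Finset.univ (fun σ => N.weight σ)
    (Finset.mem_univ (fun _ : V => (-1 : ℤˣ)))
  have e2 := Finset.add_sum_erase Finset.univ (fun σ => F (g σ).2)
    (Finset.mem_univ (fun _ : V => (-1 : ℤˣ)))
  simp only [hneg, hFneg] at e1 e2
  linarith

theorem one_le_Z (N : TensorNetwork V S) : 1 ≤ N.Z := by
  rw [Z_eq_sum_weight]
  refine le_trans ?_ (Finset.single_le_sum (f := fun σ => N.weight σ)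
    (fun σ _ => N.weight_nonneg σ) (Finset.mem_univ 1))
  have h1 : ∀ e, spinPair (1 : V → ℤˣ) e = 1 := by
    intro e
    induction e with
    | _ i j => simp [spinPair_mk]
  simp [weight, h1]

/-- The denominator in η is at least 1, so η ≤ Z - 1. With x = n_v/b ≤ K, (1+1/b)^{n_v} - 1 ≤ e^x -
1 ≤ x e^x ≤ x e^K. -/
theorem eta_le (N : TensorNetwork V S) {b : ℕ} (hb : 0 < b) (hN : ∀ e, N.bond e = b) {K : ℝ}
    (hK : (Fintype.card V : ℝ) ≤ K * b) :
    N.eta ≤ (2 * Real.exp K + 1) *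
      (Fintype.card V / b + 1 / (N.a : ℝ) ^ Fintype.card S) := by
  have hb' : (0 : ℝ) < b := by exact_mod_cast hb
  have ha : (0 : ℝ) < N.a := by exact_mod_cast N.a_pos
  have hprod : 1 ≤ ∏ v, (1 + 1 / (N.q v : ℝ)) := by
    refine Finset.one_le_prod fun v _ => ?_
    have : (0 : ℝ) ≤ 1 / (N.q v : ℝ) := by positivity
    linarith
  have h1 : N.eta ≤ N.Z - 1 := by
    have := div_le_self (zero_le_one.trans N.one_le_Z) hprod
    unfold eta; linarith
  set x : ℝ := Fintype.card V / b with hx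
  have hx0 : 0 ≤ x := by positivity
  have hxK : x ≤ K := (div_le_iff₀ hb').mpr hK
  have h2 : (1 + (b : ℝ)⁻¹) ^ Fintype.card V ≤ Real.exp x := by
    calc (1 + (b : ℝ)⁻¹) ^ Fintype.card V ≤ Real.exp (b : ℝ)⁻¹ ^ Fintype.card V := by
          gcongr; rw [add_comm]; exact Real.add_one_le_exp _
      _ = Real.exp x := by rw [← Real.exp_nat_mul, hx, div_eq_mul_inv]
  have h3 : Real.exp x - 1 ≤ x * Real.exp K := by
    have h4 : Real.exp x - 1 ≤ x * Real.exp x := by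
      have h5 := Real.add_one_le_exp (-x)
      have h6 : Real.exp (-x) * Real.exp x = 1 := by rw [← Real.exp_add]; simp
      nlinarith [Real.exp_pos x]
    exact h4.trans (by gcongr)
  have h7 := N.Z_sub_one_le hb hN
  have h8 : (0 : ℝ) ≤ 1 / (N.a : ℝ) ^ Fintype.card S := by positivity
  have h9 : ((N.a : ℝ) ^ Fintype.card S)⁻¹ = 1 / (N.a : ℝ) ^ Fintype.card S := by simp
  rw [h9] at h7
  nlinarith [Real.exp_pos K, mul_nonneg (Real.exp_pos K).le h8]

end TensorNetwork

/- ## Moments of the random tensor network state -/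

theorem Fintype.sum_sum_prod_pi {ι : Type*} [Fintype ι] [DecidableEq ι] {κ : ι → Type*}
    [∀ i, Fintype (κ i)] (f : ∀ i, κ i → κ i → ℝ) :
    ∑ x : ∀ i, κ i, ∑ y : ∀ i, κ i, ∏ i, f i (x i) (y i) = ∏ i, ∑ a, ∑ b, f i a b := by
  rw [Fintype.prod_sum]
  exact Finset.sum_congr rfl fun x _ => (Fintype.prod_sum fun i b => f i (x i) b).symm

theorem Fintype.sum_sum_sum_sum_prod_pi {ι : Type*} [Fintype ι] [DecidableEq ι] {κ : ι → Type*}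
    [∀ i, Fintype (κ i)] (f : ∀ i, κ i → κ i → κ i → κ i → ℝ) :
    ∑ x : ∀ i, κ i, ∑ y : ∀ i, κ i, ∑ z : ∀ i, κ i, ∑ w : ∀ i, κ i,
      ∏ i, f i (x i) (y i) (z i) (w i) = ∏ i, ∑ a, ∑ b, ∑ c, ∑ d, f i a b c d := by
  have e : ∀ x y : ∀ i, κ i, ∑ z : ∀ i, κ i, ∑ w : ∀ i, κ i, ∏ i, f i (x i) (y i) (z i) (w i) =
      ∏ i, ∑ c, ∑ d, f i (x i) (y i) c d :=
    fun x y => Fintype.sum_sum_prod_pi fun i c d => f i (x i) (y i) c d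
  simp_rw [e]
  exact Fintype.sum_sum_prod_pi fun i a b => ∑ c, ∑ d, f i a b c d

/-- Meant for X, Y, L the external, bond and logical labels: once the spins are fixed, the three
types of leg are summed independently. -/
theorem Fintype.sum_sum_mul_mul {X Y L : Type*} [Fintype X] [Fintype Y] [Fintype L]
    (f : X → X → ℝ) (g : Y → Y → Y → Y → ℝ) (h : L → L → L → L → ℝ) :
    ∑ p : X × (L × Y) × (L × Y), ∑ p' : X × (L × Y) × (L × Y),
      f p.1 p'.1 * g p.2.1.2 p.2.2.2 p'.2.1.2 p'.2.2.2 * h p.2.1.1 p.2.2.1 p'.2.1.1 p'.2.2.1 =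
    (∑ x, ∑ x', f x x') * (∑ y, ∑ y', ∑ z, ∑ z', g y y' z z') *
      ∑ l, ∑ l', ∑ m, ∑ m', h l l' m m' := by
  have e1 : ∑ x, ∑ x', f x x' = ∑ w : X × X, f w.1 w.2 := by rw [Fintype.sum_prod_type]
  have e2 : ∑ y, ∑ y', ∑ z, ∑ z', g y y' z z' =
      ∑ w : Y × Y × Y × Y, g w.1 w.2.1 w.2.2.1 w.2.2.2 := by simp_rw [Fintype.sum_prod_type]
  have e3 : ∑ l, ∑ l', ∑ m, ∑ m', h l l' m m' =
      ∑ w : L × L × L × L, h w.1 w.2.1 w.2.2.1 w.2.2.2 := by simp_rw [Fintype.sum_prod_type]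
  have e4 : ∀ (f' : X × X → ℝ) (g' : Y × Y × Y × Y → ℝ) (h' : L × L × L × L → ℝ),
      (∑ w, f' w) * (∑ w, g' w) * ∑ w, h' w =
        ∑ w : ((X × X) × (Y × Y × Y × Y)) × (L × L × L × L), f' w.1.1 * g' w.1.2 * h' w.2 := by
    intro f' g' h'
    rw [Fintype.sum_mul_sum, ← Fintype.sum_prod_type' fun a b => f' a * g' b, Fintype.sum_mul_sum,
      ← Fintype.sum_prod_type' fun (w : (X × X) × (Y × Y × Y × Y)) c => f' w.1 * g' w.2 * h' c]
  rw [e1, e2, e3, e4, ← Fintype.sum_prod_type' fun p p' : X × (L × Y) × (L × Y) =>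
      f p.1 p'.1 * g p.2.1.2 p.2.2.2 p'.2.1.2 p'.2.2.2 * h p.2.1.1 p.2.2.1 p'.2.1.1 p'.2.2.1]
  exact Fintype.sum_equiv
    { toFun := fun w => (((w.1.1, w.2.1), (w.1.2.1.2, w.1.2.2.2, w.2.2.1.2, w.2.2.2.2)),
        (w.1.2.1.1, w.1.2.2.1, w.2.2.1.1, w.2.2.2.1))
      invFun := fun w => ((w.1.1.1, (w.2.1, w.1.2.1), (w.2.2.1, w.1.2.2.1)),
        (w.1.1.2, (w.2.2.2.1, w.1.2.2.2.1), (w.2.2.2.2, w.1.2.2.2.2)))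
      left_inv := fun _ => rfl
      right_inv := fun _ => rfl } _ _ fun _ => rfl

/-- The components of a pair of labels picked by a spin configuration. -/
def spinMix {V : Type*} {D : V → Type*} (σ : V → ℤˣ) (l m : ∀ v, D v) : ∀ v, D v :=
  fun v => if σ v = 1 then l v else m v

/-- The purity of a pure state across any cut is at most one. -/
theorem sum_norm_spinMix_le {V : Type*} [Fintype V] [DecidableEq V] {D : V → Type*}
    [∀ v, Fintype (D v)] [∀ v, DecidableEq (D v)] (Φ : EuclideanSpace ℂ (∀ v, D v))
    (hΦ : ‖Φ‖ = 1) (σ : V → ℤˣ) :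
    ∑ l, ∑ l', ∑ m, ∑ m', ‖Φ l‖ * ‖Φ l'‖ * (‖Φ m‖ * ‖Φ m'‖) *
      (if l' = spinMix σ l m ∧ m' = spinMix σ m l then 1 else 0) ≤ 1 := by
  have hsq : ∑ l, ‖Φ l‖ ^ 2 = 1 := by rw [← EuclideanSpace.norm_sq_eq, hΦ, one_pow]
  have e : ∀ l, ∑ l', ∑ m, ∑ m', ‖Φ l‖ * ‖Φ l'‖ * (‖Φ m‖ * ‖Φ m'‖) *
      (if l' = spinMix σ l m ∧ m' = spinMix σ m l then 1 else 0) =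
      ∑ m, (‖Φ l‖ * ‖Φ m‖) * (‖Φ (spinMix σ l m)‖ * ‖Φ (spinMix σ m l)‖) := by
    intro l
    rw [Finset.sum_comm]
    refine Finset.sum_congr rfl fun m _ => ?_
    simp only [ite_and, mul_ite, mul_one, mul_zero]
    rw [Finset.sum_comm]
    simp
    ring
  simp_rw [e]
  -- Exchanging components between the two labels is an involution on pairs. Hence after 2xy ≤ x² +
  -- y² both squares sum to ‖Φ‖⁴ = 1.
  let w : ((∀ v, D v) × (∀ v, D v)) ≃ ((∀ v, D v) × (∀ v, D v)) :=
    { toFun := fun p => (spinMix σ p.1 p.2, spinMix σ p.2 p.1)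
      invFun := fun p => (spinMix σ p.1 p.2, spinMix σ p.2 p.1)
      left_inv := by
        rintro ⟨l, m⟩
        ext v <;> by_cases h : σ v = 1 <;> simp [spinMix, h]
      right_inv := by
        rintro ⟨l, m⟩
        ext v <;> by_cases h : σ v = 1 <;> simp [spinMix, h] }
  have h1 : ∑ p : (∀ v, D v) × (∀ v, D v), ‖Φ p.1‖ ^ 2 * ‖Φ p.2‖ ^ 2 = 1 := by
    rw [Fintype.sum_prod_type]
    simp_rw [← Finset.mul_sum, hsq, mul_one]
    exact hsq
  have h2 : ∑ p : (∀ v, D v) × (∀ v, D v),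
      ‖Φ (spinMix σ p.1 p.2)‖ ^ 2 * ‖Φ (spinMix σ p.2 p.1)‖ ^ 2 = 1 := by
    rw [← h1]
    exact Fintype.sum_equiv w _ _ fun _ => rfl
  calc ∑ l, ∑ m, (‖Φ l‖ * ‖Φ m‖) * (‖Φ (spinMix σ l m)‖ * ‖Φ (spinMix σ m l)‖)
      = ∑ p : (∀ v, D v) × (∀ v, D v),
        (‖Φ p.1‖ * ‖Φ p.2‖) * (‖Φ (spinMix σ p.1 p.2)‖ * ‖Φ (spinMix σ p.2 p.1)‖) := by
        rw [Fintype.sum_prod_type]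
    _ ≤ ∑ p : (∀ v, D v) × (∀ v, D v), (‖Φ p.1‖ ^ 2 * ‖Φ p.2‖ ^ 2 / 2 +
        ‖Φ (spinMix σ p.1 p.2)‖ ^ 2 * ‖Φ (spinMix σ p.2 p.1)‖ ^ 2 / 2) := by
        refine Finset.sum_le_sum fun p _ => ?_
        nlinarith [sq_nonneg (‖Φ p.1‖ * ‖Φ p.2‖ -
          ‖Φ (spinMix σ p.1 p.2)‖ * ‖Φ (spinMix σ p.2 p.1)‖)]
    _ = 1 := by
        rw [Finset.sum_add_distrib, ← Finset.sum_div, ← Finset.sum_div, h1, h2]; norm_num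

/-- The identification of the indices of two ket and two bra copies enforced by a spin. -/
def spinMatch {α : Type*} (u : ℤˣ) (y y' z z' : α) : Prop :=
  if u = 1 then y = y' ∧ z = z' else y = z' ∧ z = y'

open Classical in
/-- Contracting four copies of a bond of dimension `b` between two spins. -/
theorem sum_bond_le {V : Type*} (σ : V → ℤˣ) (e : Sym2 V) {b : ℕ} (hb : 0 < b) :
    ∑ y : Fin b, ∑ y', ∑ z, ∑ z', (if ∀ v ∈ e, spinMatch (σ v) y y' z z' then (1 : ℝ) else 0) ≤
      (b : ℝ) ^ 2 * if spinPair σ e = 1 then 1 else (b : ℝ)⁻¹ := by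
  have hb' : (b : ℝ) ≠ 0 := by exact_mod_cast hb.ne'
  have s1 : ∑ y : Fin b, ∑ y' : Fin b, ∑ z : Fin b, ∑ z' : Fin b,
      (if y = y' ∧ z = z' then (1 : ℝ) else 0) = (b : ℝ) ^ 2 := by
    simp [ite_and, sq]
  have s2 : ∑ y : Fin b, ∑ y' : Fin b, ∑ z : Fin b, ∑ z' : Fin b,
      (if y = z' ∧ z = y' then (1 : ℝ) else 0) = (b : ℝ) ^ 2 := by
    simp [ite_and, sq]
  -- Unlike end spins impose both pairings, which forces all four indices to coincide: b choices
  -- instead of b².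
  have s3 : ∑ y : Fin b, ∑ y' : Fin b, ∑ z : Fin b, ∑ z' : Fin b,
      (if y = y' ∧ z = z' ∧ y = z' then (1 : ℝ) else 0) = b := by
    simp [ite_and]
  induction e with
  | _ i j =>
    rw [spinPair_mk]
    have hle : ∀ P : Fin b → Fin b → Fin b → Fin b → Prop, ∀ [∀ y y' z z', Decidable (P y y' z z')],
        (∀ y y' z z', (∀ v ∈ s(i, j), spinMatch (σ v) y y' z z') → P y y' z z') →
        ∑ y : Fin b, ∑ y', ∑ z, ∑ z', (if ∀ v ∈ s(i, j), spinMatch (σ v) y y' z z' then (1 : ℝ) else 0) ≤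
        ∑ y, ∑ y', ∑ z, ∑ z', (if P y y' z z' then (1 : ℝ) else 0) := by
      intro P _ hP
      gcongr with y _ y' _ z _ z' _
      by_cases h : ∀ v ∈ s(i, j), spinMatch (σ v) y y' z z'
      · rw [if_pos h, if_pos (hP _ _ _ _ h)]
      · rw [if_neg h]; positivity
    by_cases hi : σ i = 1 <;> by_cases hj : σ j = 1
    · rw [if_pos (hi.trans hj.symm), if_pos rfl, mul_one, ← s1]
      refine hle _ fun y y' z z' h => ?_
      have := h i (Sym2.mem_mk_left i j)
      rwa [spinMatch, if_pos hi] at this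
    · have hij : σ i ≠ σ j := by rw [hi]; exact Ne.symm hj
      rw [if_neg hij, if_neg (by norm_num), sq, mul_assoc,
        mul_inv_cancel₀ hb', mul_one]
      conv_rhs => rw [← s3]
      refine hle _ fun y y' z z' h => ?_
      have h1 := h i (Sym2.mem_mk_left i j)
      have h2 := h j (Sym2.mem_mk_right i j)
      rw [spinMatch, if_pos hi] at h1
      rw [spinMatch, if_neg hj] at h2
      exact ⟨h1.1, h1.2, h2.1⟩
    · have hij : σ i ≠ σ j := by rw [hj]; exact hi
      rw [if_neg hij, if_neg (by norm_num), sq, mul_assoc,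
        mul_inv_cancel₀ hb', mul_one]
      conv_rhs => rw [← s3]
      refine hle _ fun y y' z z' h => ?_
      have h1 := h j (Sym2.mem_mk_right i j)
      have h2 := h i (Sym2.mem_mk_left i j)
      rw [spinMatch, if_pos hj] at h1
      rw [spinMatch, if_neg hi] at h2
      exact ⟨h1.1, h1.2, h2.1⟩
    · have hij : σ i = σ j := by
        rw [(Int.units_eq_one_or _).resolve_left hi, (Int.units_eq_one_or _).resolve_left hj]
      rw [if_pos hij, if_pos rfl, mul_one, ← s2]
      refine hle _ fun y y' z z' h => ?_
      have := h i (Sym2.mem_mk_left i j)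
      rwa [spinMatch, if_neg hi] at this

/-! ### Mean of the squared norm -/

namespace TensorNetwork

variable {V S : Type*} [Fintype V] [DecidableEq V] [Fintype S] [DecidableEq S]

theorem integrable_law (N : TensorNetwork V S) {E : Type*} [NormedAddCommGroup E]
    {f : N.Sample → E} (hf : Continuous f) : Integrable f N.law :=
  hf.integrable_of_hasCompactSupport (HasCompactSupport.of_compactSpace f)

/-- The leg label at a vertex induced by labels of all external, logical and internal legs. -/
def leg (N : TensorNetwork V S) (x : S → Fin N.a)
    (k : (∀ v, Fin (N.d v)) × (∀ e : N.Edge, Fin (N.bond e))) (v : V) : N.Idx v :=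
  (fun s => x s.1, fun e => k.2 e.1, k.1 v)

theorem card_Idx (N : TensorNetwork V S) (v : V) : Fintype.card (N.Idx v) = N.q v := by
  have : Fintype.card (N.Idx v) = Fintype.card (({s : S // N.site s = v} → Fin N.a) ×
    (∀ e : {e : N.Edge // v ∈ N.ends e}, Fin (N.bond e.1)) × Fin (N.d v)) := rfl
  rw [this]
  simp [q]
  ring

theorem leg_eq_leg (N : TensorNetwork V S) (x x' : S → Fin N.a)
    (k k' : (∀ v, Fin (N.d v)) × (∀ e : N.Edge, Fin (N.bond e))) (v : V) :
    N.leg x k v = N.leg x' k' v ↔ (∀ s, N.site s = v → x s = x' s) ∧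
      (∀ e, v ∈ N.ends e → k.2 e = k'.2 e) ∧ k.1 v = k'.1 v := by
  unfold leg Idx
  simp [Prod.ext_iff, funext_iff]

theorem q_pos (N : TensorNetwork V S) (v : V) : 0 < N.q v :=
  Nat.mul_pos (Nat.mul_pos (pow_pos N.a_pos _) (N.d_pos v))
    (Finset.prod_pos fun e _ => N.bond_pos e.1)

/-- The components of the random tensor at `v`. -/
def tensor (N : TensorNetwork V S) (ref : ∀ v, EuclideanSpace ℂ (N.Idx v)) (U : N.Sample) (v : V) :
    N.Idx v → ℂ :=
  haarVec (ref v).ofLp (U v)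

theorem psi_apply (N : TensorNetwork V S) (Φ : N.Bulk) (ref : ∀ v, EuclideanSpace ℂ (N.Idx v))
    (U : N.Sample) (x : S → Fin N.a) : N.psi Φ ref U x =
      ∑ k : (∀ v, Fin (N.d v)) × (∀ e : N.Edge, Fin (N.bond e)),
        star (Φ k.1) * ∏ v, N.tensor ref U v (N.leg x k v) := by
  rw [Fintype.sum_prod_type]
  rfl

@[fun_prop]
theorem continuous_tensor (N : TensorNetwork V S) (ref : ∀ v, EuclideanSpace ℂ (N.Idx v)) (v : V)
    (i : N.Idx v) : Continuous fun U => N.tensor ref U v i :=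
  (continuous_haarVec_apply (ref v).ofLp i).comp (continuous_apply v)

theorem continuous_psi (N : TensorNetwork V S) (Φ : N.Bulk)
    (ref : ∀ v, EuclideanSpace ℂ (N.Idx v)) : Continuous (N.psi Φ ref) := by
  have h : Continuous fun U x => N.psi Φ ref U x := by
    refine continuous_pi fun x => ?_
    simp_rw [psi_apply]
    exact continuous_finsetSum _ fun k _ => continuous_const.mul
      (continuous_finsetProd _ fun v _ => N.continuous_tensor ref v _)
  exact (PiLp.continuous_toLp 2 _).comp h

theorem continuous_normSq (N : TensorNetwork V S) (Φ : N.Bulk)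
    (ref : ∀ v, EuclideanSpace ℂ (N.Idx v)) : Continuous (N.normSq Φ ref) :=
  (N.continuous_psi Φ ref).norm.pow 2

theorem continuous_expval (N : TensorNetwork V S) (Φ : N.Bulk)
    (ref : ∀ v, EuclideanSpace ℂ (N.Idx v)) (O : N.Boundary →L[ℂ] N.Boundary) :
    Continuous (N.expval Φ ref O) :=
  Complex.continuous_re.comp
    ((N.continuous_psi Φ ref).inner (O.continuous.comp (N.continuous_psi Φ ref)))

/-- Labels of the legs of one ket and one bra copy of the network with common external labels. -/
abbrev Pair (N : TensorNetwork V S) : Type _ :=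
  (S → Fin N.a) × ((∀ v, Fin (N.d v)) × (∀ e : N.Edge, Fin (N.bond e))) ×
    ((∀ v, Fin (N.d v)) × (∀ e : N.Edge, Fin (N.bond e)))

theorem normSq_eq_sum (N : TensorNetwork V S) (Φ : N.Bulk)
    (ref : ∀ v, EuclideanSpace ℂ (N.Idx v)) (U : N.Sample) :
    (N.normSq Φ ref U : ℂ) = ∑ p : N.Pair, star (Φ p.2.1.1) * Φ p.2.2.1 *
      ∏ v, N.tensor ref U v (N.leg p.1 p.2.1 v) * star (N.tensor ref U v (N.leg p.1 p.2.2 v)) := by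
  rw [normSq, EuclideanSpace.norm_sq_eq]
  push_cast
  rw [Fintype.sum_prod_type]
  refine Finset.sum_congr rfl fun x _ => ?_
  rw [Fintype.sum_prod_type, ← Complex.mul_conj', psi_apply, map_sum, Fintype.sum_mul_sum]
  refine Finset.sum_congr rfl fun k _ => Finset.sum_congr rfl fun k' _ => ?_
  simp only [map_mul, map_prod, Finset.prod_mul_distrib, Complex.star_def, Complex.conj_conj]
  ring

theorem _root_.EuclideanSpace.sum_mul_star_self {ι : Type*} [Fintype ι] {r : EuclideanSpace ℂ ι} (hr : ‖r‖ = 1) :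
    ∑ i, r.ofLp i * star (r.ofLp i) = 1 := by
  have h := EuclideanSpace.norm_sq_eq r
  rw [hr, one_pow] at h
  have h2 := congrArg (fun x : ℝ => (x : ℂ)) h
  push_cast at h2
  simp only [Complex.star_def, Complex.mul_conj']
  exact h2.symm

/-- The mean of `⟨ψ|ψ⟩`. -/
theorem integral_normSq (N : TensorNetwork V S) (Φ : N.Bulk)
    (ref : ∀ v, EuclideanSpace ℂ (N.Idx v)) (hΦ : ‖Φ‖ = 1) (href : ∀ v, ‖ref v‖ = 1) :
    ∫ U, N.normSq Φ ref U ∂N.law =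
      (N.a : ℝ) ^ Fintype.card S * (∏ e, (N.bond e : ℝ)) / ∏ v, (N.q v : ℝ) := by
  have hsq' : ∑ l, star (Φ l) * Φ l = 1 := by
    rw [← EuclideanSpace.sum_mul_star_self hΦ]
    exact Finset.sum_congr rfl fun l _ => mul_comm _ _
  -- Second moments force ket and bra labels to agree at every vertex. Every edge has an end point,
  -- so the bond and logical labels agree globally.
  have hk : ∀ (x : S → Fin N.a) (k k' : (∀ v, Fin (N.d v)) × (∀ e : N.Edge, Fin (N.bond e))),
      (∏ v, ((if N.leg x k v = N.leg x k' v then 1 else 0) / (N.q v : ℂ))) =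
        (if k = k' then 1 else 0) / ∏ v, (N.q v : ℂ) := by
    intro x k k'
    rw [Finset.prod_div_distrib]
    congr 1
    by_cases h : k = k'
    · simp [h]
    · rw [if_neg h]
      have : ∃ v, N.leg x k v ≠ N.leg x k' v := by
        by_contra hcon
        push Not at hcon
        simp_rw [leg_eq_leg] at hcon
        refine h (Prod.ext (funext fun v => (hcon v).2.2) (funext fun e => ?_))
        obtain ⟨v, hv⟩ : ∃ v, v ∈ N.ends e := by
          induction N.ends e with
          | _ i j => exact ⟨i, Sym2.mem_mk_left i j⟩
        exact (hcon v).2.1 e hv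
      obtain ⟨v, hv⟩ := this
      exact Finset.prod_eq_zero (Finset.mem_univ v) (if_neg hv)
  have hint : ((∫ U, N.normSq Φ ref U ∂N.law : ℝ) : ℂ) =
      ∑ p : N.Pair, star (Φ p.2.1.1) * Φ p.2.2.1 *
        ((if p.2.1 = p.2.2 then 1 else 0) / ∏ v, (N.q v : ℂ)) := by
    rw [← integral_complex_ofReal]
    simp_rw [normSq_eq_sum]
    rw [integral_finsetSum _ fun p _ => N.integrable_law (by fun_prop)]
    refine Finset.sum_congr rfl fun p _ => ?_
    rw [integral_const_mul, ← hk p.1]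
    congr 1
    unfold law tensor
    rw [integral_fintype_prod_eq_prod (fun v (u : Matrix.unitaryGroup (N.Idx v) ℂ) =>
      haarVec (ref v).ofLp u (N.leg p.1 p.2.1 v) *
        star (haarVec (ref v).ofLp u (N.leg p.1 p.2.2 v)))]
    refine Finset.prod_congr rfl fun v _ => ?_
    rw [integral_haarVec_mul_star (EuclideanSpace.sum_mul_star_self (href v)), card_Idx]
  -- On the diagonal, external labels contribute a^n, bond labels the product of the bond
  -- dimensions, and logical labels ‖Φ‖² = 1.
  have hfin : ∑ p : N.Pair, star (Φ p.2.1.1) * Φ p.2.2.1 *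
        ((if p.2.1 = p.2.2 then 1 else 0) / ∏ v, (N.q v : ℂ)) =
      (N.a : ℂ) ^ Fintype.card S * (∏ e, (N.bond e : ℂ)) / ∏ v, (N.q v : ℂ) := by
    simp_rw [← mul_div_assoc]
    rw [← Finset.sum_div]
    congr 1
    rw [Fintype.sum_prod_type]
    simp_rw [Fintype.sum_prod_type (α₁ := (∀ v, Fin (N.d v)) × (∀ e : N.Edge, Fin (N.bond e))),
      mul_ite, mul_one, mul_zero, Finset.sum_ite_eq, Finset.mem_univ, if_true]
    simp_rw [Fintype.sum_prod_type, Finset.sum_const, ← Finset.smul_sum, hsq']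
    simp
  apply Complex.ofReal_injective
  rw [hint, hfin]
  push_cast
  rfl

end TensorNetwork

/-! ### Second moment of the squared norm as an Ising sum -/

open Classical in
-- This is where spins enter: +1 pairs each ket with the bra of its own copy, -1 with that of the
-- other copy.
theorem haarMoment_eq_sum_spinMatch {n : Type*} [Fintype n] [DecidableEq n] {r : n → ℂ}
    (hr : ∑ i, r i * star (r i) = 1) (i j k l : n) :
    haarMoment r i j k l = ((∑ u : ℤˣ, if spinMatch u i j k l then (1 : ℝ) else 0) /
      (Fintype.card n * (Fintype.card n + 1)) : ℝ) := by
  rw [haarMoment_eq hr, show (Finset.univ : Finset ℤˣ) = {1, -1} from rfl,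
    Finset.sum_pair (by decide)]
  simp only [spinMatch, if_true, show ((-1 : ℤˣ) = 1) = False from by decide, if_false]
  split_ifs <;> simp

namespace TensorNetwork

variable {V S : Type*} [Fintype V] [DecidableEq V] [Fintype S] [DecidableEq S]

/-- Independence of the tensors turns the average of a product over vertices into a product of
one-vertex fourth moments. -/
theorem integral_normSq_sq_eq (N : TensorNetwork V S) (Φ : N.Bulk)
    (ref : ∀ v, EuclideanSpace ℂ (N.Idx v)) :
    ((∫ U, N.normSq Φ ref U ^ 2 ∂N.law : ℝ) : ℂ) =
      ∑ p : N.Pair, ∑ p' : N.Pair,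
        (star (Φ p.2.1.1) * Φ p.2.2.1) * (star (Φ p'.2.1.1) * Φ p'.2.2.1) *
        ∏ v, haarMoment (ref v).ofLp (N.leg p.1 p.2.1 v) (N.leg p.1 p.2.2 v)
          (N.leg p'.1 p'.2.1 v) (N.leg p'.1 p'.2.2 v) := by
  rw [← integral_complex_ofReal]
  have e : ∀ U, ((N.normSq Φ ref U ^ 2 : ℝ) : ℂ) = ∑ p : N.Pair, ∑ p' : N.Pair,
      (star (Φ p.2.1.1) * Φ p.2.2.1) * (star (Φ p'.2.1.1) * Φ p'.2.2.1) *
        ∏ v, N.tensor ref U v (N.leg p.1 p.2.1 v) * star (N.tensor ref U v (N.leg p.1 p.2.2 v)) *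
          (N.tensor ref U v (N.leg p'.1 p'.2.1 v) *
            star (N.tensor ref U v (N.leg p'.1 p'.2.2 v))) := by
    intro U
    push_cast
    rw [normSq_eq_sum, sq, Fintype.sum_mul_sum]
    refine Finset.sum_congr rfl fun p _ => Finset.sum_congr rfl fun p' _ => ?_
    rw [mul_mul_mul_comm, ← Finset.prod_mul_distrib]
  simp_rw [e]
  rw [integral_finsetSum _ fun p _ => N.integrable_law (by fun_prop)]
  refine Finset.sum_congr rfl fun p _ => ?_
  rw [integral_finsetSum _ fun p _ => N.integrable_law (by fun_prop)]
  refine Finset.sum_congr rfl fun p' _ => ?_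
  rw [integral_const_mul]
  congr 1
  unfold law tensor
  rw [integral_fintype_prod_eq_prod (fun v (u : Matrix.unitaryGroup (N.Idx v) ℂ) =>
    haarVec (ref v).ofLp u (N.leg p.1 p.2.1 v) * star (haarVec (ref v).ofLp u (N.leg p.1 p.2.2 v)) *
      (haarVec (ref v).ofLp u (N.leg p'.1 p'.2.1 v) *
        star (haarVec (ref v).ofLp u (N.leg p'.1 p'.2.2 v))))]
  rfl

open Classical in
/-- The identification of leg labels enforced by a spin configuration splits into external,
internal and logical legs. -/
theorem prod_spinMatch_le (N : TensorNetwork V S) (σ : V → ℤˣ) (p p' : N.Pair) :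
    ∏ v, (if spinMatch (σ v) (N.leg p.1 p.2.1 v) (N.leg p.1 p.2.2 v)
        (N.leg p'.1 p'.2.1 v) (N.leg p'.1 p'.2.2 v) then (1 : ℝ) else 0) ≤
      (∏ s, if σ (N.site s) = 1 ∨ p.1 s = p'.1 s then (1 : ℝ) else 0) *
        (∏ e, if ∀ v ∈ N.ends e, spinMatch (σ v) (p.2.1.2 e) (p.2.2.2 e) (p'.2.1.2 e) (p'.2.2.2 e)
          then (1 : ℝ) else 0) *
        (if p.2.2.1 = spinMix σ p.2.1.1 p'.2.1.1 ∧ p'.2.2.1 = spinMix σ p'.2.1.1 p.2.1.1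
          then 1 else 0) := by
  by_cases h : ∀ v, spinMatch (σ v) (N.leg p.1 p.2.1 v) (N.leg p.1 p.2.2 v)
        (N.leg p'.1 p'.2.1 v) (N.leg p'.1 p'.2.2 v)
  · have hs : ∀ s, σ (N.site s) = 1 ∨ p.1 s = p'.1 s := by
      intro s
      by_cases h1 : σ (N.site s) = 1
      · exact Or.inl h1
      · have := h (N.site s)
        simp only [spinMatch, if_neg h1, leg_eq_leg] at this
        exact Or.inr (this.1.1 s rfl)
    have he : ∀ e, ∀ v ∈ N.ends e,
        spinMatch (σ v) (p.2.1.2 e) (p.2.2.2 e) (p'.2.1.2 e) (p'.2.2.2 e) := by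
      intro e v hv
      have := h v
      by_cases h1 : σ v = 1
      · simp only [spinMatch, if_pos h1, leg_eq_leg] at this ⊢
        exact ⟨this.1.2.1 e hv, this.2.2.1 e hv⟩
      · simp only [spinMatch, if_neg h1, leg_eq_leg] at this ⊢
        exact ⟨this.1.2.1 e hv, this.2.2.1 e hv⟩
    have hl : p.2.2.1 = spinMix σ p.2.1.1 p'.2.1.1 ∧ p'.2.2.1 = spinMix σ p'.2.1.1 p.2.1.1 := by
      constructor <;> ext1 v <;> have := h v <;> by_cases h1 : σ v = 1
      · simp only [spinMatch, if_pos h1, leg_eq_leg] at this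
        simp only [spinMix, if_pos h1, this.1.2.2]
      · simp only [spinMatch, if_neg h1, leg_eq_leg] at this
        simp only [spinMix, if_neg h1, this.2.2.2]
      · simp only [spinMatch, if_pos h1, leg_eq_leg] at this
        simp only [spinMix, if_pos h1, this.2.2.2]
      · simp only [spinMatch, if_neg h1, leg_eq_leg] at this
        simp only [spinMix, if_neg h1, this.1.2.2]
    rw [if_pos hl, Finset.prod_congr rfl fun v _ => if_pos (h v),
      Finset.prod_congr rfl fun s _ => if_pos (hs s),
      Finset.prod_congr rfl fun e _ => if_pos (he e)]
    simp
  · push Not at h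
    obtain ⟨v, hv⟩ := h
    rw [Finset.prod_eq_zero (Finset.mem_univ v) (if_neg hv)]
    refine mul_nonneg (mul_nonneg (Finset.prod_nonneg fun s _ => ?_)
      (Finset.prod_nonneg fun e _ => ?_)) ?_ <;> positivity

theorem sum_external_eq (N : TensorNetwork V S) (σ : V → ℤˣ) :
    ∑ x : S → Fin N.a, ∑ x' : S → Fin N.a,
      (∏ s, if σ (N.site s) = 1 ∨ x s = x' s then (1 : ℝ) else 0) =
    ∏ s, (N.a : ℝ) ^ 2 * if σ (N.site s) = 1 then 1 else (N.a : ℝ)⁻¹ := by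
  have ha : (N.a : ℝ) ≠ 0 := by exact_mod_cast N.a_pos.ne'
  rw [Fintype.sum_sum_prod_pi
    (fun s (i j : Fin N.a) => if σ (N.site s) = 1 ∨ i = j then (1 : ℝ) else 0)]
  refine Finset.prod_congr rfl fun s _ => ?_
  by_cases h : σ (N.site s) = 1
  · simp [h, sq]
  · simp [h]
    field_simp

open Classical in
theorem sum_internal_le (N : TensorNetwork V S) (σ : V → ℤˣ) :
    ∑ y : ∀ e : N.Edge, Fin (N.bond e), ∑ y' : ∀ e : N.Edge, Fin (N.bond e),
      ∑ z : ∀ e : N.Edge, Fin (N.bond e), ∑ z' : ∀ e : N.Edge, Fin (N.bond e),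
      (∏ e, if ∀ v ∈ N.ends e, spinMatch (σ v) (y e) (y' e) (z e) (z' e)
        then (1 : ℝ) else 0) ≤
    ∏ e, (N.bond e : ℝ) ^ 2 *
      if spinPair σ (N.ends e) = 1 then 1 else (N.bond e : ℝ)⁻¹ := by
  rw [Fintype.sum_sum_sum_sum_prod_pi (fun e (i j k l : Fin (N.bond e)) =>
    if ∀ v ∈ N.ends e, spinMatch (σ v) i j k l then (1 : ℝ) else 0)]
  refine Finset.prod_le_prod (fun e _ => ?_) fun e _ => ?_
  · positivity
  · refine le_of_eq_of_le ?_ (sum_bond_le σ (N.ends e) (N.bond_pos e))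
    congr! 10

open Classical in
/-- The contribution of a spin configuration to the second moment of `⟨ψ|ψ⟩`. -/
theorem sum_spinMatch_le_weight (N : TensorNetwork V S) (Φ : N.Bulk) (hΦ : ‖Φ‖ = 1)
    (σ : V → ℤˣ) :
    ∑ p : N.Pair, ∑ p' : N.Pair, (‖Φ p.2.1.1‖ * ‖Φ p.2.2.1‖ * (‖Φ p'.2.1.1‖ * ‖Φ p'.2.2.1‖)) *
      ∏ v, (if spinMatch (σ v) (N.leg p.1 p.2.1 v) (N.leg p.1 p.2.2 v)
        (N.leg p'.1 p'.2.1 v) (N.leg p'.1 p'.2.2 v) then (1 : ℝ) else 0) ≤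
      ((N.a : ℝ) ^ Fintype.card S * ∏ e, (N.bond e : ℝ)) ^ 2 * N.weight σ := by
  calc _ ≤ ∑ p : N.Pair, ∑ p' : N.Pair,
        (∏ s, if σ (N.site s) = 1 ∨ p.1 s = p'.1 s then (1 : ℝ) else 0) *
        (∏ e, if ∀ v ∈ N.ends e, spinMatch (σ v) (p.2.1.2 e) (p.2.2.2 e) (p'.2.1.2 e) (p'.2.2.2 e)
          then (1 : ℝ) else 0) *
        (‖Φ p.2.1.1‖ * ‖Φ p.2.2.1‖ * (‖Φ p'.2.1.1‖ * ‖Φ p'.2.2.1‖) *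
          (if p.2.2.1 = spinMix σ p.2.1.1 p'.2.1.1 ∧ p'.2.2.1 = spinMix σ p'.2.1.1 p.2.1.1
          then 1 else 0)) := by
        refine Finset.sum_le_sum fun p _ => Finset.sum_le_sum fun p' _ => ?_
        refine (mul_le_mul_of_nonneg_left (N.prod_spinMatch_le σ p p') (by positivity)).trans_eq ?_
        ring
    _ = _ := Fintype.sum_sum_mul_mul
        (fun x x' : S → Fin N.a => ∏ s, if σ (N.site s) = 1 ∨ x s = x' s then (1 : ℝ) else 0)
        (fun y y' z z' : ∀ e : N.Edge, Fin (N.bond e) =>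
          ∏ e, if ∀ v ∈ N.ends e, spinMatch (σ v) (y e) (y' e) (z e) (z' e) then (1 : ℝ) else 0)
        (fun l l' m m' : ∀ v, Fin (N.d v) => ‖Φ l‖ * ‖Φ l'‖ * (‖Φ m‖ * ‖Φ m'‖) *
          (if l' = spinMix σ l m ∧ m' = spinMix σ m l then 1 else 0))
    _ ≤ (∏ s, (N.a : ℝ) ^ 2 * if σ (N.site s) = 1 then 1 else (N.a : ℝ)⁻¹) *
        (∏ e, (N.bond e : ℝ) ^ 2 * if spinPair σ (N.ends e) = 1 then 1 else (N.bond e : ℝ)⁻¹) *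
        1 := by
        rw [N.sum_external_eq σ]
        refine mul_le_mul (mul_le_mul_of_nonneg_left (N.sum_internal_le σ)
          (Finset.prod_nonneg fun s _ => ?_)) ?_
          (Finset.sum_nonneg fun l _ => Finset.sum_nonneg fun l' _ => Finset.sum_nonneg fun m _ =>
            Finset.sum_nonneg fun m' _ => ?_)
          (mul_nonneg (Finset.prod_nonneg fun s _ => ?_) (Finset.prod_nonneg fun e _ => ?_))
        · positivity
        · convert sum_norm_spinMix_le Φ hΦ σ
        · positivity
        · positivity
        · positivity
    _ = _ := by
        simp only [weight, Finset.prod_mul_distrib, Finset.prod_pow, Finset.prod_const,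
          Finset.card_univ]
        ring

open Classical in
/-- The second moment of `⟨ψ|ψ⟩` is bounded by the Ising partition function. -/
theorem integral_normSq_sq_le (N : TensorNetwork V S) (Φ : N.Bulk)
    (ref : ∀ v, EuclideanSpace ℂ (N.Idx v)) (hΦ : ‖Φ‖ = 1) (href : ∀ v, ‖ref v‖ = 1) :
    ∫ U, N.normSq Φ ref U ^ 2 ∂N.law ≤
      (∫ U, N.normSq Φ ref U ∂N.law) ^ 2 * (N.Z / ∏ v, (1 + 1 / (N.q v : ℝ))) := by
  have h0 : (0 : ℝ) ≤ ∫ U, N.normSq Φ ref U ^ 2 ∂N.law :=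
    integral_nonneg fun U => sq_nonneg _
  have hq : ∀ v, (0 : ℝ) < N.q v := fun v => by exact_mod_cast N.q_pos v
  have h1 : ∫ U, N.normSq Φ ref U ^ 2 ∂N.law ≤ ∑ p : N.Pair, ∑ p' : N.Pair,
      (‖Φ p.2.1.1‖ * ‖Φ p.2.2.1‖ * (‖Φ p'.2.1.1‖ * ‖Φ p'.2.2.1‖)) *
      ∏ v, ((∑ u : ℤˣ, if spinMatch u (N.leg p.1 p.2.1 v) (N.leg p.1 p.2.2 v)
        (N.leg p'.1 p'.2.1 v) (N.leg p'.1 p'.2.2 v) then (1 : ℝ) else 0) /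
          (N.q v * (N.q v + 1))) := by
    -- Passing to absolute values discards the phases of Φ; the moments are nonnegative and the
    -- purity bound involves only the moduli |Φ l|.
    rw [← Real.norm_of_nonneg h0, ← Complex.norm_real, integral_normSq_sq_eq]
    refine (norm_sum_le _ _).trans (Finset.sum_le_sum fun p _ =>
      (norm_sum_le _ _).trans (Finset.sum_le_sum fun p' _ => ?_))
    rw [norm_mul, norm_mul, norm_mul, norm_mul, norm_star, norm_star, norm_prod]
    refine le_of_eq (congrArg _ (Finset.prod_congr rfl fun v _ => ?_))
    rw [haarMoment_eq_sum_spinMatch (EuclideanSpace.sum_mul_star_self (href v)), Complex.norm_real,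
      Real.norm_of_nonneg (by positivity), card_Idx]
  -- Expanding the product over vertices of two-term sums yields the sum over spin configurations.
  have h2 : ∀ p p' : N.Pair,
      ∏ v, ((∑ u : ℤˣ, if spinMatch u (N.leg p.1 p.2.1 v) (N.leg p.1 p.2.2 v)
        (N.leg p'.1 p'.2.1 v) (N.leg p'.1 p'.2.2 v) then (1 : ℝ) else 0) /
          ((N.q v : ℝ) * (N.q v + 1))) =
      (∑ σ : V → ℤˣ, ∏ v, if spinMatch (σ v) (N.leg p.1 p.2.1 v) (N.leg p.1 p.2.2 v)
        (N.leg p'.1 p'.2.1 v) (N.leg p'.1 p'.2.2 v) then (1 : ℝ) else 0) /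
          ∏ v, ((N.q v : ℝ) * (N.q v + 1)) := by
    intro p p'
    rw [Finset.prod_div_distrib, Fintype.prod_sum]
  simp_rw [h2, ← mul_div_assoc, ← Finset.sum_div, Finset.mul_sum] at h1
  rw [Finset.sum_congr rfl fun p _ => Finset.sum_comm, Finset.sum_comm] at h1
  refine h1.trans ?_
  have h3 := Finset.sum_le_sum fun σ (_ : σ ∈ (Finset.univ : Finset (V → ℤˣ))) =>
    N.sum_spinMatch_le_weight Φ hΦ σ
  have hQ : (0 : ℝ) < ∏ v, ((N.q v : ℝ) * (N.q v + 1)) :=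
    Finset.prod_pos fun v _ => mul_pos (hq v) (by linarith [hq v])
  refine (div_le_div_of_nonneg_right h3 hQ.le).trans_eq ?_
  rw [← Finset.mul_sum, ← Z_eq_sum_weight, integral_normSq N Φ ref hΦ href]
  -- The factor q² matches the squared mean; 1 + 1/q is what remains.
  have hprod : ∏ v, ((N.q v : ℝ) * (N.q v + 1)) =
      (∏ v, (N.q v : ℝ)) ^ 2 * ∏ v, (1 + 1 / (N.q v : ℝ)) := by
    rw [← Finset.prod_pow, ← Finset.prod_mul_distrib]
    refine Finset.prod_congr rfl fun v _ => ?_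
    have := (hq v).ne'
    field_simp
  rw [hprod, div_pow, div_mul_div_comm]

end TensorNetwork

/-! ### Concentration of the norm and normalized expectation values -/

namespace TensorNetwork

variable {V S : Type*} [Fintype V] [DecidableEq V] [Fintype S] [DecidableEq S]

theorem integral_normSq_pos (N : TensorNetwork V S) (Φ : N.Bulk)
    (ref : ∀ v, EuclideanSpace ℂ (N.Idx v)) (hΦ : ‖Φ‖ = 1) (href : ∀ v, ‖ref v‖ = 1) :
    0 < ∫ U, N.normSq Φ ref U ∂N.law := by
  rw [integral_normSq N Φ ref hΦ href]
  have ha : (0 : ℝ) < N.a := by exact_mod_cast N.a_pos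
  refine div_pos (mul_pos (pow_pos ha _) (Finset.prod_pos fun e _ => ?_))
    (Finset.prod_pos fun v _ => ?_)
  · exact_mod_cast N.bond_pos e
  · exact_mod_cast N.q_pos v

/-- The relative variance of `⟨ψ|ψ⟩` is at most `η`. -/
theorem integral_sq_normSq_div_sub_one_le (N : TensorNetwork V S) (Φ : N.Bulk)
    (ref : ∀ v, EuclideanSpace ℂ (N.Idx v)) (hΦ : ‖Φ‖ = 1) (href : ∀ v, ‖ref v‖ = 1) :
    ∫ U, (N.normSq Φ ref U / (∫ U', N.normSq Φ ref U' ∂N.law) - 1) ^ 2 ∂N.law ≤ N.eta := by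
  have hpos := N.integral_normSq_pos Φ ref hΦ href
  have hle := N.integral_normSq_sq_le Φ ref hΦ href
  have hc := N.continuous_normSq Φ ref
  set m := ∫ U, N.normSq Φ ref U ∂N.law with hm
  have e : ∀ U, (N.normSq Φ ref U / m - 1) ^ 2 =
      (m ^ 2)⁻¹ * N.normSq Φ ref U ^ 2 - 2 / m * N.normSq Φ ref U + 1 := by
    intro U; field_simp; ring
  simp_rw [e]
  rw [integral_add (N.integrable_law (by fun_prop)) (integrable_const _),
    integral_sub (N.integrable_law (by fun_prop)) (N.integrable_law (by fun_prop)),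
    integral_const_mul, integral_const_mul, ← hm]
  simp only [integral_const, probReal_univ, smul_eq_mul, mul_one, eta]
  have h1 : (m ^ 2)⁻¹ * ∫ U, N.normSq Φ ref U ^ 2 ∂N.law ≤
      N.Z / ∏ v, (1 + 1 / (N.q v : ℝ)) := by
    rw [inv_mul_le_iff₀ (by positivity)]; exact hle
  have h2 : 2 / m * m = 2 := by field_simp
  linarith

theorem abs_expval_le (N : TensorNetwork V S) (Φ : N.Bulk)
    (ref : ∀ v, EuclideanSpace ℂ (N.Idx v)) (O : N.Boundary →L[ℂ] N.Boundary) (U : N.Sample) :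
    |N.expval Φ ref O U| ≤ ‖O‖ * N.normSq Φ ref U := by
  refine (Complex.abs_re_le_norm _).trans ((norm_inner_le_norm _ _).trans ?_)
  rw [normSq, sq]
  nlinarith [O.le_opNorm (N.psi Φ ref U), norm_nonneg (N.psi Φ ref U)]

theorem normSq_nonneg (N : TensorNetwork V S) (Φ : N.Bulk)
    (ref : ∀ v, EuclideanSpace ℂ (N.Idx v)) (U : N.Sample) : 0 ≤ N.normSq Φ ref U :=
  sq_nonneg _

/-- Cauchy–Schwarz gives it where ψ ≠ 0; where ψ = 0 the quotient is 0 by convention. The bound also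
yields integrability of the quotient, which need not be continuous. -/
theorem abs_expval_div_le (N : TensorNetwork V S) (Φ : N.Bulk)
    (ref : ∀ v, EuclideanSpace ℂ (N.Idx v)) (O : N.Boundary →L[ℂ] N.Boundary) (U : N.Sample) :
    |N.expval Φ ref O U / N.normSq Φ ref U| ≤ ‖O‖ := by
  rw [abs_div, abs_of_nonneg (N.normSq_nonneg Φ ref U)]
  exact div_le_of_le_mul₀ (N.normSq_nonneg Φ ref U) (norm_nonneg O) (N.abs_expval_le Φ ref O U)

theorem integrable_expval_div (N : TensorNetwork V S) (Φ : N.Bulk)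
    (ref : ∀ v, EuclideanSpace ℂ (N.Idx v)) (O : N.Boundary →L[ℂ] N.Boundary) :
    Integrable (fun U => N.expval Φ ref O U / N.normSq Φ ref U) N.law :=
  Integrable.of_bound ((N.continuous_expval Φ ref O).measurable.div
    (N.continuous_normSq Φ ref).measurable).aestronglyMeasurable ‖O‖
    (Filter.Eventually.of_forall fun U => N.abs_expval_div_le Φ ref O U)

/-- The mean absolute deviation is at most the standard deviation. -/
theorem _root_.MeasureTheory.integral_abs_le_sqrt {Ω : Type*} [MeasurableSpace Ω] {μ : Measure Ω}
    [IsProbabilityMeasure μ] {f : Ω → ℝ} (hf : Integrable f μ)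
    (hf2 : Integrable (fun ω => f ω ^ 2) μ) : ∫ ω, |f ω| ∂μ ≤ Real.sqrt (∫ ω, f ω ^ 2 ∂μ) := by
  refine Real.le_sqrt_of_sq_le ?_
  set c := ∫ ω, |f ω| ∂μ with hc
  -- Nonnegativity of the variance of |f|.
  have h : 0 ≤ ∫ ω, (|f ω| - c) ^ 2 ∂μ := integral_nonneg fun ω => sq_nonneg _
  have e : ∀ ω, (|f ω| - c) ^ 2 = f ω ^ 2 - 2 * c * |f ω| + c ^ 2 := by
    intro ω; rw [← sq_abs (f ω)]; ring
  simp_rw [e] at h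
  have hi : Integrable (fun ω => 2 * c * |f ω|) μ := hf.abs.const_mul _
  have hs : Integrable (fun ω => f ω ^ 2 - 2 * c * |f ω|) μ := hf2.sub hi
  rw [integral_add hs (integrable_const _), integral_sub hf2 hi, integral_const_mul, ← hc] at h
  simp only [integral_const, probReal_univ, smul_eq_mul, one_mul] at h
  linarith

theorem abs_integral_expval_div_sub_le (N : TensorNetwork V S) (Φ : N.Bulk)
    (ref : ∀ v, EuclideanSpace ℂ (N.Idx v)) (O : N.Boundary →L[ℂ] N.Boundary)
    (hΦ : ‖Φ‖ = 1) (href : ∀ v, ‖ref v‖ = 1) :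
    |(∫ U, N.expval Φ ref O U / N.normSq Φ ref U ∂N.law) -
      (∫ U, N.expval Φ ref O U ∂N.law) / (∫ U, N.normSq Φ ref U ∂N.law)| ≤
      Real.sqrt N.eta * ‖O‖ := by
  have hpos := N.integral_normSq_pos Φ ref hΦ href
  have hvar := N.integral_sq_normSq_div_sub_one_le Φ ref hΦ href
  have hcn := N.continuous_normSq Φ ref
  have hce := N.continuous_expval Φ ref O
  set m := ∫ U, N.normSq Φ ref U ∂N.law
  have hcf : Continuous fun U => N.normSq Φ ref U / m - 1 := by fun_prop
  rw [← integral_div, ← integral_sub (N.integrable_expval_div Φ ref O)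
    (N.integrable_law (by fun_prop))]
  calc |∫ U, (N.expval Φ ref O U / N.normSq Φ ref U - N.expval Φ ref O U / m) ∂N.law|
      ≤ ∫ U, |N.expval Φ ref O U / N.normSq Φ ref U - N.expval Φ ref O U / m| ∂N.law :=
        abs_integral_le_integral_abs
    _ ≤ ∫ U, ‖O‖ * |N.normSq Φ ref U / m - 1| ∂N.law := by
        refine integral_mono ((N.integrable_expval_div Φ ref O).sub
          (N.integrable_law (by fun_prop))).abs (N.integrable_law (by fun_prop)) fun U => ?_
        -- The identity survives where the norm vanishes, because the numerator then vanishes too.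
        have e : N.expval Φ ref O U / N.normSq Φ ref U - N.expval Φ ref O U / m =
            -(N.expval Φ ref O U / N.normSq Φ ref U * (N.normSq Φ ref U / m - 1)) := by
          by_cases h : N.normSq Φ ref U = 0
          · have := N.abs_expval_le Φ ref O U
            rw [h, mul_zero] at this
            simp [h, abs_nonpos_iff.mp this]
          · field_simp; ring
        simp only [e, abs_neg, abs_mul]
        exact mul_le_mul_of_nonneg_right (N.abs_expval_div_le Φ ref O U) (abs_nonneg _)
    _ = ‖O‖ * ∫ U, |N.normSq Φ ref U / m - 1| ∂N.law := integral_const_mul _ _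
    _ ≤ ‖O‖ * Real.sqrt N.eta := by
        gcongr
        exact (integral_abs_le_sqrt (N.integrable_law hcf) (N.integrable_law (hcf.pow 2))).trans
          (Real.sqrt_le_sqrt hvar)
    _ = Real.sqrt N.eta * ‖O‖ := mul_comm _ _

end TensorNetwork


end

/-! ### Assembly of the three assertions -/

theorem mainTheorem11 :
    -- the large deviation bound
    (∀ (V S : Type*) [Fintype V] [DecidableEq V] [Fintype S] [DecidableEq S]
      (N : TensorNetwork V S) (Φ : N.Bulk) (ref : ∀ v, EuclideanSpace ℂ (N.Idx v)),
      ‖Φ‖ = 1 → (∀ v, ‖ref v‖ = 1) →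
        Integrable (N.normSq Φ ref) N.law ∧ 0 < ∫ U, N.normSq Φ ref U ∂N.law ∧
        ∀ ε : ℝ, 0 < ε →
          N.law.real {U | ε ≤ (N.normSq Φ ref U / (∫ U', N.normSq Φ ref U' ∂N.law) - 1) ^ 2}
            ≤ 1 / ε * (N.Z / ∏ v, (1 + 1 / (N.q v : ℝ)) - 1)) ∧
    -- its asymptotic form, for constant bond dimension `b`
    (∀ K : ℝ, ∃ C : ℝ, ∀ (V S : Type*) [Fintype V] [DecidableEq V] [Fintype S] [DecidableEq S]
      (N : TensorNetwork V S) (b : ℕ), 0 < b → (∀ e, N.bond e = b) →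
        (Fintype.card V : ℝ) ≤ K * b →
        ∀ ε : ℝ, 0 < ε →
          1 / ε * (N.Z / ∏ v, (1 + 1 / (N.q v : ℝ)) - 1) ≤
            C * (Fintype.card V / (ε * b) + 1 / (ε * (N.a : ℝ) ^ Fintype.card S))) ∧
    -- normalized versus on-average-normalized expectation values
    (∀ (V S : Type*) [Fintype V] [DecidableEq V] [Fintype S] [DecidableEq S]
      (N : TensorNetwork V S) (Φ : N.Bulk) (ref : ∀ v, EuclideanSpace ℂ (N.Idx v))
      (O : N.Boundary →L[ℂ] N.Boundary),
      ‖Φ‖ = 1 → (∀ v, ‖ref v‖ = 1) → IsSelfAdjoint O →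
        Integrable (N.expval Φ ref O) N.law ∧
        Integrable (fun U => N.expval Φ ref O U / N.normSq Φ ref U) N.law ∧
        |(∫ U, N.expval Φ ref O U / N.normSq Φ ref U ∂N.law) -
            (∫ U, N.expval Φ ref O U ∂N.law) / (∫ U, N.normSq Φ ref U ∂N.law)|
          ≤ Real.sqrt N.eta * ‖O‖ ∧
        (0 ≤ ∫ U, N.expval Φ ref O U ∂N.law → ∀ ε : ℝ, 0 < ε → ε < 1 →
          (∫ U, N.expval Φ ref O U / N.normSq Φ ref U ∂N.law) ≤
              (∫ U, N.expval Φ ref O U ∂N.law) / (∫ U, N.normSq Φ ref U ∂N.law) *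
                (1 / (1 - Real.sqrt ε)) + Real.sqrt N.eta * ‖O‖ ∧
          (∫ U, N.expval Φ ref O U ∂N.law) / (∫ U, N.normSq Φ ref U ∂N.law) *
                (1 / (1 + Real.sqrt ε)) - Real.sqrt N.eta * ‖O‖ ≤
            ∫ U, N.expval Φ ref O U / N.normSq Φ ref U ∂N.law)) := by
  refine ⟨?_, ?_, ?_⟩
  · intro V S _ _ _ _ N Φ ref hΦ href
    refine ⟨N.integrable_law (N.continuous_normSq Φ ref), N.integral_normSq_pos Φ ref hΦ href,
      fun ε hε => ?_⟩
    have hcn := N.continuous_normSq Φ ref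
    -- Markov's inequality for the squared relative deviation.
    have h := mul_meas_ge_le_integral_of_nonneg (μ := N.law)
      (f := fun U => (N.normSq Φ ref U / (∫ U', N.normSq Φ ref U' ∂N.law) - 1) ^ 2)
      (Filter.Eventually.of_forall fun U => sq_nonneg _) (N.integrable_law (by fun_prop)) ε
    have h2 := h.trans (N.integral_sq_normSq_div_sub_one_le Φ ref hΦ href)
    rw [one_div, le_inv_mul_iff₀ hε]
    exact h2
  · intro K
    refine ⟨2 * Real.exp K + 1, ?_⟩
    intro V S _ _ _ _ N b hb hN hK ε hε
    have h := mul_le_mul_of_nonneg_left (N.eta_le hb hN hK) (one_div_pos.mpr hε).le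
    refine h.trans_eq ?_
    have hb' : (b : ℝ) ≠ 0 := by exact_mod_cast hb.ne'
    have ha : (N.a : ℝ) ≠ 0 := by exact_mod_cast N.a_pos.ne'
    field_simp
  · intro V S _ _ _ _ N Φ ref O hΦ href _
    have hmain := N.abs_integral_expval_div_sub_le Φ ref O hΦ href
    refine ⟨N.integrable_law (N.continuous_expval Φ ref O), N.integrable_expval_div Φ ref O,
      hmain, fun hO ε hε hε1 => ?_⟩
    obtain ⟨h1, h2⟩ := abs_le.mp hmain
    have hr := div_nonneg hO (N.integral_normSq_pos Φ ref hΦ href).le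
    have hs : 0 < Real.sqrt ε := Real.sqrt_pos.mpr hε
    have hs1 : Real.sqrt ε < 1 := by
      rw [Real.sqrt_lt' one_pos]; simpa using hε1
    -- The ratio of means is nonnegative, so the factors 1/(1 ∓ √ε) only weaken the two-sided bound
    -- already proved.
    have h3 := le_mul_of_one_le_right hr
      ((one_le_div (by linarith)).mpr (by linarith : 1 - Real.sqrt ε ≤ 1))
    have h4 := mul_le_of_le_one_right hr
      ((div_le_one (by linarith)).mpr (by linarith : 1 ≤ 1 + Real.sqrt ε))
    constructor <;> linarith
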